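/- Let $d\ge 1$, and let $\Gamma$ be the metric graph corresponding to the complete graph $K_d$ on $d$ vertices, with all edge lengths equal to $1$. A divisor on $\Gamma$ is a finite formal $\mathbb{Z}$-linear combination of points of $\Gamma$; its degree is the sum of its coefficients, and it is effective if all coefficients are $\ge 0$. A rational function on $\Gamma$ is a continuous function $f:\Gamma\to\mathbb{R}$ that is piecewise linear with integer slopes and finitely many pieces; $\operatorname{div}(f)$ is the divisor whose coefficient at $p$ is the sum of the incoming slopes of $f$ at $p$; and $D_1\sim D_2$ means $D_1-D_2=\operatorname{div}(f)$ for some rational function $f$. Write $|D|$ for the set of effective divisors linearly equivalent to $D$. The rank of $D$ is $-1$ if $|D|=\emptyset$, and otherwise it is the largest integer $n\ge 0$ such that $|D-E|\neq\emptyset$ for every effective divisor $E$ of degree $n$. For $r\ge 1$ let $\gamma_r$ be the minimal degree of a divisor of rank $r$. The same notions are used for the finite graph $K_d$, with divisors supported on the vertices and with $\operatorname{div}(f)=\sum_v\big(\sum_{vw\in E(K_d)}(f(v)-f(w))\big)(v)$ for $f:V(K_d)\to\mathbb{Z}$. Theorem. Put $g=\frac{(d-1)(d-2)}{2}$. The metric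 graph $\Gamma$ has the same gonality sequence $(\gamma_r)_{r\ge 1}$ as the finite graph $K_d$, and it is given by $$\gamma_r=\begin{cases} kd-h & \text{if } r<g,\\ g+r & \text{if } r\ge g,\end{cases}$$ where, for $1\le r<g$, $k$ and $h$ are the uniquely determined integers with $1\le k\le d-3$ and $0\le h\le k$ such that $r=\frac{k(k+3)}{2}-h$. -/

import Mathlib

/-! ## Linear systems, rank and gonality

A divisor on a set `P` of points is an element `D : P →₀ ℤ` of the free abelian group on `P`; it is
effective if `0 ≤ D` (coefficientwise).  The notions of this section only depend on the relation of
linear equivalence, and are used below for finite graphs and for metric graphs. -/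

/-- The degree of a divisor: the sum of its coefficients. -/
def divisorDegree {P : Type*} (D : P →₀ ℤ) : ℤ := D.sum fun _ n => n

/-- The linear system `|D|`: the effective divisors that are linearly equivalent to `D`. -/
def linearSystem {P : Type*} (equiv : (P →₀ ℤ) → (P →₀ ℤ) → Prop) (D : P →₀ ℤ) :
    Set (P →₀ ℤ) :=
  {E | 0 ≤ E ∧ equiv E D}

/-- `HasRank equiv D r`: the rank of the divisor `D` is `r`.  The rank is `-1` if `|D|` is empty,
and otherwise it is the largest `n ≥ 0` such that `|D - E|` is nonempty for every effective divisor
`E` of degree `n`. -/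
def HasRank {P : Type*} (equiv : (P →₀ ℤ) → (P →₀ ℤ) → Prop) (D : P →₀ ℤ) (r : ℤ) : Prop :=
  (linearSystem equiv D = ∅ ∧ r = -1) ∨
  ((linearSystem equiv D).Nonempty ∧
    IsGreatest {n : ℤ | 0 ≤ n ∧ ∀ E : P →₀ ℤ, 0 ≤ E → divisorDegree E = n →
      (linearSystem equiv (D - E)).Nonempty} r)

/-- `IsGonality equiv r s`: the `r`-th term of the gonality sequence is `s`, i.e. `s` is the minimal
degree of a divisor of rank `r`. -/
def IsGonality {P : Type*} (equiv : (P →₀ ℤ) → (P →₀ ℤ) → Prop) (r s : ℤ) : Prop :=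
  IsLeast {n : ℤ | ∃ D : P →₀ ℤ, divisorDegree D = n ∧ HasRank equiv D r} s

/-! ## Finite graphs -/

/-- The coefficient at `v` of the principal divisor of `f : V → ℤ` on the finite graph `G`. -/
def SimpleGraph.divCoeff {V : Type*} (G : SimpleGraph V) [Fintype V] [DecidableRel G.Adj]
    (f : V → ℤ) (v : V) : ℤ :=
  ∑ w ∈ G.neighborFinset v, (f v - f w)

/-- Linear equivalence of divisors on a finite graph: `D₁ - D₂ = div f` for some `f : V → ℤ`. -/
def SimpleGraph.LinEquiv {V : Type*} (G : SimpleGraph V) [Fintype V] [DecidableRel G.Adj]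
    (D₁ D₂ : V →₀ ℤ) : Prop :=
  ∃ f : V → ℤ, ∀ v, (D₁ - D₂) v = G.divCoeff f v

/-! ## Metric graphs -/

/-- Combinatorial data of a metric graph with vertex set `V` and edge set `E`: every edge is given
an (auxiliary) orientation and a positive length. -/
structure MetricGraph (V E : Type*) where
  src : E → V
  tgt : E → V
  len : E → ℝ
  len_pos : ∀ e, 0 < len e

namespace MetricGraph

variable {V E : Type*} (Γ : MetricGraph V E)

/-- The points of a metric graph: the vertices, and for each edge `e` the points of the open segment
`(0, len e)`. -/
inductive Point : Type _
  | vertex (v : V) : Point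
  | interior (e : E) (t : ℝ) (ht : t ∈ Set.Ioo 0 (Γ.len e)) : Point

open Classical in
/-- Parametrization of the closed edge `e` by arc length `t ∈ [0, len e]`, from `src e` to `tgt e`
(extended by constants outside `[0, len e]`). -/
noncomputable def edgePoint (e : E) (t : ℝ) : Γ.Point :=
  if h₀ : t ≤ 0 then Point.vertex (Γ.src e)
  else if h₁ : Γ.len e ≤ t then Point.vertex (Γ.tgt e)
  else Point.interior e t ⟨not_le.mp h₀, not_le.mp h₁⟩

/-- Rational functions on a metric graph: along each closed edge the function is continuous and
piecewise linear with integer slopes and finitely many pieces; that is, there is a finite set `S` of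
break points such that the function is affine with integer slope on each closed subinterval whose
interior contains no break point.  (A function on `Γ` is continuous if and only if it is so along
each closed edge.) -/
def IsRational (f : Γ.Point → ℝ) : Prop :=
  ∀ e : E, ContinuousOn (fun t => f (Γ.edgePoint e t)) (Set.Icc 0 (Γ.len e)) ∧
    ∃ S : Finset ℝ, ∀ a b : ℝ, 0 ≤ a → a ≤ b → b ≤ Γ.len e →
      (∀ s ∈ S, s ∉ Set.Ioo a b) →
      ∃ m : ℤ, ∀ t ∈ Set.Icc a b,
        f (Γ.edgePoint e t) = f (Γ.edgePoint e a) + m * (t - a)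

/-- The slope of `f` along `e` just after the parameter `t` (in the direction of `e`). -/
noncomputable def rightSlope (f : Γ.Point → ℝ) (e : E) (t : ℝ) : ℝ :=
  derivWithin (fun s => f (Γ.edgePoint e s)) (Set.Ici t) t

/-- The slope of `f` along `e` just before the parameter `t` (in the direction of `e`). -/
noncomputable def leftSlope (f : Γ.Point → ℝ) (e : E) (t : ℝ) : ℝ :=
  derivWithin (fun s => f (Γ.edgePoint e s)) (Set.Iic t) t

open Classical in
/-- The coefficient of the principal divisor of `f` at a point: the sum of the incoming slopes
of `f` at that point.  (For rational `f` these are integers.) -/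
noncomputable def divCoeff [Fintype E] (f : Γ.Point → ℝ) : Γ.Point → ℝ
  | Point.vertex v =>
      ∑ e : E, ((if Γ.src e = v then -Γ.rightSlope f e 0 else 0) +
        (if Γ.tgt e = v then Γ.leftSlope f e (Γ.len e) else 0))
  | Point.interior e t _ => Γ.leftSlope f e t - Γ.rightSlope f e t

/-- Linear equivalence of divisors on a metric graph: `D₁ - D₂ = div f` for some rational
function `f`. -/
def LinEquiv [Fintype E] (D₁ D₂ : Γ.Point →₀ ℤ) : Prop :=
  ∃ f : Γ.Point → ℝ, Γ.IsRational f ∧ ∀ p, (((D₁ - D₂) p : ℤ) : ℝ) = Γ.divCoeff f p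

end MetricGraph

/-- The metric graph corresponding to a finite simple graph `G`: same vertices, same edges, all edge
lengths `1`.  The edge `{u, v}` with `u < v` is oriented from `u` to `v`. -/
def SimpleGraph.toMetricGraph {V : Type*} [LinearOrder V] (G : SimpleGraph V) :
    MetricGraph V {p : V × V // G.Adj p.1 p.2 ∧ p.1 < p.2} where
  src e := e.1.1
  tgt e := e.1.2
  len _ := 1
  len_pos _ := one_pos

/-! Every class on the metric graph has a normal form: integers at the vertices together with one
chip on each edge at a real position, a position outside [0, 1] recording chips carried along the
whole edge. Changing the positions by differences of a potential `h : V → ℝ` stays in the class, so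
the problem becomes chip firing with real firing amounts.

Non-effectivity is certified by an order on the vertices (`linearSystem_eq_empty_of_le`). Rewrite
the divisor so that the single chip left on each edge avoids the earlier endpoint. If all vertex
coefficients are then at most -1, looking at the minimum set of a rational function shows that no
equivalent divisor is effective. On the complete graph, Dhar's burning algorithm with real firing
amounts (`exists_reduced_order`) yields a representative reduced at a vertex, with an order in which
all other coefficients are at most -1: so either the representative is effective or the order is a
certificate.

Lower bound (`le_divisorDegree_of_rank`): let `c` be the coefficient of the reduced representative
at its base vertex. Fire that vertex by just enough to remove `c + 1` chips, spread as evenly as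
possible over the other vertices. Subtracting a suitable vertex divisor `E` then produces a
certificate, so deg `E` > `r`. The greedy burning order makes the coefficients a monotone lattice
path and deg `E` its excess over a staircase, and `sum_ge_of_lt_sum` turns this into 2 deg `D` ≥
2`r` + 2`k``m` - `k`(`k` + 1), where `m` = d - 1.

Upper bound (`exists_divisor_of_rank`): a divisor with the same coefficient at all vertices, minus a
multiple of one vertex, works on K_d by an induction that fires a vertex. Vertices determine rank on
the metric graph (`linearSystem_sub_interior_nonempty`) and finite equivalence implies metric
equivalence. Hence the upper bound passes from K_d to the metric graph, the lower bound passes back,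
and the two sequences agree. -/

section

open Set Filter Topology

namespace MetricGraph

/-! ### One-sided slopes of rational functions, and linear equivalence -/

section Slopes

variable {V E : Type*} {Γ : MetricGraph V E}

theorem edgePoint_of_nonpos (e : E) {t : ℝ} (h : t ≤ 0) :
    Γ.edgePoint e t = Point.vertex (Γ.src e) := by
  simp [edgePoint, h]

theorem edgePoint_zero (e : E) : Γ.edgePoint e 0 = Point.vertex (Γ.src e) :=
  edgePoint_of_nonpos e le_rfl

theorem edgePoint_len (e : E) : Γ.edgePoint e (Γ.len e) = Point.vertex (Γ.tgt e) := by
  simp [edgePoint, Γ.len_pos e]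

theorem edgePoint_interior (e : E) {t : ℝ} (ht : t ∈ Ioo 0 (Γ.len e)) :
    Γ.edgePoint e t = Point.interior e t ht := by
  unfold edgePoint
  rw [dif_neg (not_le.mpr ht.1), dif_neg (not_le.mpr ht.2)]

theorem edgePoint_eq_interior_iff {e e' : E} {t t' : ℝ} (ht : t ∈ Ioo 0 (Γ.len e)) :
    Γ.edgePoint e' t' = Point.interior e t ht ↔ e' = e ∧ t' = t := by
  constructor
  · intro h
    unfold edgePoint at h
    split_ifs at h
    cases h
    exact ⟨rfl, rfl⟩
  · rintro ⟨rfl, rfl⟩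
    exact edgePoint_interior _ ht

theorem edgePoint_eq_vertex_iff {e : E} {v : V} {t : ℝ} (ht : t ∈ Icc 0 (Γ.len e)) :
    Γ.edgePoint e t = Point.vertex v ↔
      (t = 0 ∧ Γ.src e = v) ∨ (t = Γ.len e ∧ Γ.tgt e = v) := by
  have hl := Γ.len_pos e
  unfold edgePoint
  split_ifs with h₀ h₁
  · have : t = 0 := le_antisymm h₀ ht.1
    subst this
    simp [hl.ne]
  · have : t = Γ.len e := le_antisymm ht.2 h₁
    subst this
    simp [hl.ne']
  · push Not at h₀ h₁
    simp [h₀.ne', h₁.ne]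

/-- Finitely many break points leave an interval just to the right of `t` free of them. The
derivative feeds `rightSlope`; the affine formula feeds the sign arguments at minima. -/
theorem IsRational.exists_right {f : Γ.Point → ℝ} (hf : Γ.IsRational f) (e : E) {t : ℝ}
    (h0 : 0 ≤ t) (h1 : t < Γ.len e) :
    ∃ m : ℤ, HasDerivWithinAt (fun s => f (Γ.edgePoint e s)) m (Ici t) t ∧
      ∃ u > t, u ≤ Γ.len e ∧
        ∀ x ∈ Icc t u, f (Γ.edgePoint e x) = f (Γ.edgePoint e t) + m * (x - t) := by
  obtain ⟨S, hS⟩ := (hf e).2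
  have hev : ∀ᶠ u in 𝓝[>] t, ∀ s ∈ S, s ∉ Ioo t u := by
    rw [eventually_all_finset]
    intro s _
    rcases le_or_gt s t with h | h
    · exact Eventually.of_forall fun u hu => absurd hu.1 (not_lt.mpr h)
    · filter_upwards [Ioo_mem_nhdsGT h] with u hu hsu
      exact lt_asymm hsu.2 hu.2
  obtain ⟨u, hu, hut⟩ := (hev.and (Ioo_mem_nhdsGT h1)).exists
  obtain ⟨m, hm⟩ := hS t u h0 hut.1.le hut.2.le hu
  refine ⟨m, ?_, u, hut.1, hut.2.le, hm⟩
  have hlin : HasDerivWithinAt (fun x : ℝ => f (Γ.edgePoint e t) + m * (x - t)) m (Ici t) t := by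
    simpa using ((((hasDerivAt_id t).sub_const t).const_mul (m : ℝ)).const_add
      (f (Γ.edgePoint e t))).hasDerivWithinAt (s := Ici t)
  refine hlin.congr_of_eventuallyEq ?_ (by simp)
  filter_upwards [Icc_mem_nhdsGE hut.1] with x hx using hm x hx

theorem IsRational.exists_left {f : Γ.Point → ℝ} (hf : Γ.IsRational f) (e : E) {t : ℝ}
    (h0 : 0 < t) (h1 : t ≤ Γ.len e) :
    ∃ m : ℤ, HasDerivWithinAt (fun s => f (Γ.edgePoint e s)) m (Iic t) t ∧
      ∃ u < t, 0 ≤ u ∧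
        ∀ x ∈ Icc u t, f (Γ.edgePoint e x) = f (Γ.edgePoint e t) + m * (x - t) := by
  obtain ⟨S, hS⟩ := (hf e).2
  have hev : ∀ᶠ u in 𝓝[<] t, ∀ s ∈ S, s ∉ Ioo u t := by
    rw [eventually_all_finset]
    intro s _
    rcases le_or_gt t s with h | h
    · exact Eventually.of_forall fun u hu => absurd hu.2 (not_lt.mpr h)
    · filter_upwards [Ioo_mem_nhdsLT h] with u hu hsu
      exact lt_asymm hsu.1 hu.1
  obtain ⟨u, hu, hut⟩ := (hev.and (Ioo_mem_nhdsLT h0)).exists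
  obtain ⟨m, hm⟩ := hS u t hut.1.le hut.2.le h1 hu
  have hm' : ∀ x ∈ Icc u t, f (Γ.edgePoint e x) = f (Γ.edgePoint e t) + m * (x - t) := by
    intro x hx
    rw [hm x hx, hm t ⟨hut.2.le, le_rfl⟩]
    ring
  refine ⟨m, ?_, u, hut.2, hut.1.le, hm'⟩
  have hlin : HasDerivWithinAt (fun x : ℝ => f (Γ.edgePoint e t) + m * (x - t)) m (Iic t) t := by
    simpa using ((((hasDerivAt_id t).sub_const t).const_mul (m : ℝ)).const_add
      (f (Γ.edgePoint e t))).hasDerivWithinAt (s := Iic t)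
  refine hlin.congr_of_eventuallyEq ?_ (by simp)
  filter_upwards [Icc_mem_nhdsLE hut.2] with x hx using hm' x hx

theorem rightSlope_eq {f : Γ.Point → ℝ} {e : E} {t m : ℝ}
    (h : HasDerivWithinAt (fun s => f (Γ.edgePoint e s)) m (Ici t) t) :
    Γ.rightSlope f e t = m :=
  h.derivWithin (uniqueDiffWithinAt_Ici t)

theorem leftSlope_eq {f : Γ.Point → ℝ} {e : E} {t m : ℝ}
    (h : HasDerivWithinAt (fun s => f (Γ.edgePoint e s)) m (Iic t) t) :
    Γ.leftSlope f e t = m :=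
  h.derivWithin (uniqueDiffWithinAt_Iic t)

theorem IsRational.rightSlope_add {f g : Γ.Point → ℝ} (hf : Γ.IsRational f) (hg : Γ.IsRational g)
    (e : E) {t : ℝ} (h0 : 0 ≤ t) (h1 : t < Γ.len e) :
    Γ.rightSlope (f + g) e t = Γ.rightSlope f e t + Γ.rightSlope g e t := by
  obtain ⟨m, hm, -⟩ := hf.exists_right e h0 h1
  obtain ⟨n, hn, -⟩ := hg.exists_right e h0 h1
  rw [rightSlope_eq hm, rightSlope_eq hn]
  exact rightSlope_eq (hm.add hn)

theorem IsRational.leftSlope_add {f g : Γ.Point → ℝ} (hf : Γ.IsRational f) (hg : Γ.IsRational g)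
    (e : E) {t : ℝ} (h0 : 0 < t) (h1 : t ≤ Γ.len e) :
    Γ.leftSlope (f + g) e t = Γ.leftSlope f e t + Γ.leftSlope g e t := by
  obtain ⟨m, hm, -⟩ := hf.exists_left e h0 h1
  obtain ⟨n, hn, -⟩ := hg.exists_left e h0 h1
  rw [leftSlope_eq hm, leftSlope_eq hn]
  exact leftSlope_eq (hm.add hn)

theorem IsRational.add {f g : Γ.Point → ℝ} (hf : Γ.IsRational f) (hg : Γ.IsRational g) :
    Γ.IsRational (f + g) := by
  classical
  intro e
  obtain ⟨hcf, S, hS⟩ := hf e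
  obtain ⟨hcg, T, hT⟩ := hg e
  refine ⟨hcf.add hcg, S ∪ T, fun a b ha hab hb hST => ?_⟩
  obtain ⟨m, hm⟩ := hS a b ha hab hb fun s hs => hST s (Finset.mem_union_left _ hs)
  obtain ⟨n, hn⟩ := hT a b ha hab hb fun s hs => hST s (Finset.mem_union_right _ hs)
  refine ⟨m + n, fun t ht => ?_⟩
  simp only [Pi.add_apply, hm t ht, hn t ht]
  push_cast
  ring

theorem IsRational.divCoeff_add [Fintype E] {f g : Γ.Point → ℝ} (hf : Γ.IsRational f)
    (hg : Γ.IsRational g) (p : Γ.Point) :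
    Γ.divCoeff (f + g) p = Γ.divCoeff f p + Γ.divCoeff g p := by
  cases p with
  | vertex v =>
    simp only [divCoeff, ← Finset.sum_add_distrib]
    refine Finset.sum_congr rfl fun e _ => ?_
    rw [hf.rightSlope_add hg e le_rfl (Γ.len_pos e), hf.leftSlope_add hg e (Γ.len_pos e) le_rfl]
    split_ifs <;> ring
  | interior e t ht =>
    simp only [divCoeff]
    rw [hf.rightSlope_add hg e ht.1.le ht.2, hf.leftSlope_add hg e ht.1 ht.2.le]
    ring

theorem LinEquiv.trans [Fintype E] {D₁ D₂ D₃ : Γ.Point →₀ ℤ} (h : Γ.LinEquiv D₁ D₂)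
    (h' : Γ.LinEquiv D₂ D₃) : Γ.LinEquiv D₁ D₃ := by
  obtain ⟨f, hf, hfd⟩ := h
  obtain ⟨g, hg, hgd⟩ := h'
  refine ⟨f + g, hf.add hg, fun p => ?_⟩
  rw [hf.divCoeff_add hg, ← hfd, ← hgd]
  simp

theorem LinEquiv.add_right [Fintype E] {D₁ D₂ : Γ.Point →₀ ℤ} (h : Γ.LinEquiv D₁ D₂)
    (D : Γ.Point →₀ ℤ) : Γ.LinEquiv (D₁ + D) (D₂ + D) := by
  obtain ⟨f, hf, hfd⟩ := h
  exact ⟨f, hf, fun p => by rw [← hfd]; simp⟩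

theorem LinEquiv.sub_right [Fintype E] {D₁ D₂ : Γ.Point →₀ ℤ} (h : Γ.LinEquiv D₁ D₂)
    (D : Γ.Point →₀ ℤ) : Γ.LinEquiv (D₁ - D) (D₂ - D) := by
  simpa [sub_eq_add_neg] using h.add_right (-D)

end Slopes

/-! ### Linear equivalences from explicit ramp functions -/

section Ramps

variable {V E : Type*} {Γ : MetricGraph V E}

theorem hasDerivWithinAt_min_Ici (s t : ℝ) :
    HasDerivWithinAt (fun x : ℝ => min x s) (if t < s then 1 else 0) (Ici t) t := by
  split_ifs with h
  · refine (hasDerivWithinAt_id t _).congr_of_eventuallyEq ?_ (min_eq_left h.le)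
    filter_upwards [Icc_mem_nhdsGE h] with x hx using min_eq_left hx.2
  · push Not at h
    refine (hasDerivWithinAt_const t _ s).congr_of_eventuallyEq ?_ (min_eq_right h)
    filter_upwards [self_mem_nhdsWithin] with x hx using min_eq_right (h.trans hx)

theorem hasDerivWithinAt_min_Iic (s t : ℝ) :
    HasDerivWithinAt (fun x : ℝ => min x s) (if t ≤ s then 1 else 0) (Iic t) t := by
  split_ifs with h
  · refine (hasDerivWithinAt_id t _).congr_of_eventuallyEq ?_ (min_eq_left h)
    filter_upwards [self_mem_nhdsWithin] with x hx using min_eq_left (le_trans hx h)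
  · push Not at h
    refine (hasDerivWithinAt_const t _ s).congr_of_eventuallyEq ?_ (min_eq_right h.le)
    filter_upwards [Icc_mem_nhdsLE h] with x hx using min_eq_right hx.1

/-- The edge `e` part of a function with ramps of slope `n i` on the initial segments of length
`s i` of the edges `ed i`. -/
noncomputable def rampSum {ι : Type*} [Fintype ι] [DecidableEq E] (ed : ι → E) (s : ι → ℝ)
    (n : ι → ℤ) (e : E) (t : ℝ) : ℝ :=
  ∑ i, if ed i = e then n i * min t (s i) else 0

theorem ramp_vertex_aux (c : ℝ) {l s : ℝ} (hl : 0 < l) (hs : s ∈ Icc 0 l) (P Q : Prop)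
    [Decidable P] [Decidable Q] [Decidable ((s = 0 ∧ P) ∨ (s = l ∧ Q))] :
    (if P then -(c * (if 0 < s then 1 else 0)) else 0) +
      (if Q then c * (if l ≤ s then 1 else 0) else 0) =
    c * ((if (s = 0 ∧ P) ∨ (s = l ∧ Q) then 1 else 0) - (if P then 1 else 0)) := by
  rcases hs.1.eq_or_lt with rfl | h0
  · by_cases hP : P <;> simp [hP, hl.ne, hl.not_ge]
  · rcases hs.2.eq_or_lt with rfl | h1
    · by_cases hP : P <;> by_cases hQ : Q <;> simp [hP, hQ, hl, hl.ne']
    · by_cases hP : P <;> simp [hP, h0, h0.ne', h1.ne, not_le.mpr h1]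

/-- The function is `h` at the source of each edge plus the ramps on that edge, and `hh` makes it
match `h` at the target. A ramp of slope `n i` stopping at `s i` contributes `n i` there and `-n i`
at the source. -/
theorem linEquiv_of_ramps [Fintype E] [DecidableEq E] {ι : Type*} [Fintype ι]
    (ed : ι → E) (s : ι → ℝ)
    (hs : ∀ i, s i ∈ Icc 0 (Γ.len (ed i))) (n : ι → ℤ) (h : V → ℝ)
    (hh : ∀ e, rampSum ed s n e (Γ.len e) = h (Γ.tgt e) - h (Γ.src e)) {D₁ D₂ : Γ.Point →₀ ℤ}
    (hD : D₁ - D₂ = ∑ i, n i • (Finsupp.single (Γ.edgePoint (ed i) (s i)) 1 -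
      Finsupp.single (Point.vertex (Γ.src (ed i))) 1)) : Γ.LinEquiv D₁ D₂ := by
  classical
  let f : Γ.Point → ℝ := fun p => match p with
    | Point.vertex v => h v
    | Point.interior e t _ => h (Γ.src e) + rampSum ed s n e t
  have hf : ∀ e, ∀ t ∈ Icc 0 (Γ.len e),
      f (Γ.edgePoint e t) = h (Γ.src e) + rampSum ed s n e t := by
    intro e t ht
    rcases ht.1.eq_or_lt with h0 | h0
    · subst h0
      rw [edgePoint_zero]
      have : rampSum ed s n e 0 = 0 := by
        refine Finset.sum_eq_zero fun i _ => ?_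
        rw [min_eq_left (hs i).1]
        simp
      simp [f, this]
    · rcases ht.2.eq_or_lt with h1 | h1
      · rw [h1, edgePoint_len, hh]
        simp [f]
      · rw [edgePoint_interior e ⟨h0, h1⟩]
  have hr : ∀ e t, HasDerivWithinAt (fun t => h (Γ.src e) + rampSum ed s n e t)
      (∑ i, if ed i = e then (n i : ℝ) * (if t < s i then 1 else 0) else 0) (Ici t) t := by
    intro e t
    refine HasDerivWithinAt.const_add _ (HasDerivWithinAt.fun_sum fun i _ => ?_)
    split_ifs with h1 h2
    · simpa [h2] using (hasDerivWithinAt_min_Ici (s i) t).const_mul (n i : ℝ)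
    · simpa [h2] using (hasDerivWithinAt_min_Ici (s i) t).const_mul (n i : ℝ)
    · exact hasDerivWithinAt_const _ _ _
  have hl : ∀ e t, HasDerivWithinAt (fun t => h (Γ.src e) + rampSum ed s n e t)
      (∑ i, if ed i = e then (n i : ℝ) * (if t ≤ s i then 1 else 0) else 0) (Iic t) t := by
    intro e t
    refine HasDerivWithinAt.const_add _ (HasDerivWithinAt.fun_sum fun i _ => ?_)
    split_ifs with h1 h2
    · simpa [h2] using (hasDerivWithinAt_min_Iic (s i) t).const_mul (n i : ℝ)
    · simpa [h2] using (hasDerivWithinAt_min_Iic (s i) t).const_mul (n i : ℝ)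
    · exact hasDerivWithinAt_const _ _ _
  have hright : ∀ e, ∀ t, 0 ≤ t → t < Γ.len e → Γ.rightSlope f e t =
      ∑ i, if ed i = e then (n i : ℝ) * (if t < s i then 1 else 0) else 0 := by
    intro e t h0 h1
    refine rightSlope_eq ((hr e t).congr_of_eventuallyEq ?_ (hf e t ⟨h0, h1.le⟩))
    filter_upwards [Icc_mem_nhdsGE h1] with x hx using hf e x ⟨h0.trans hx.1, hx.2⟩
  have hleft : ∀ e, ∀ t, 0 < t → t ≤ Γ.len e → Γ.leftSlope f e t =
      ∑ i, if ed i = e then (n i : ℝ) * (if t ≤ s i then 1 else 0) else 0 := by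
    intro e t h0 h1
    refine leftSlope_eq ((hl e t).congr_of_eventuallyEq ?_ (hf e t ⟨h0.le, h1⟩))
    filter_upwards [Icc_mem_nhdsLE h0] with x hx using hf e x ⟨hx.1, hx.2.trans h1⟩
  refine ⟨f, fun e => ⟨?_, Finset.univ.image s, ?_⟩, ?_⟩
  · refine ContinuousOn.congr ?_ (hf e)
    unfold rampSum
    refine Continuous.continuousOn (continuous_const.add (continuous_finsetSum _ fun i _ => ?_))
    split_ifs <;> fun_prop
  · intro a b ha hab hb hS
    refine ⟨∑ i, if ed i = e ∧ b ≤ s i then n i else 0, fun t ht => ?_⟩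
    rw [hf e t ⟨ha.trans ht.1, ht.2.trans hb⟩, hf e a ⟨ha, hab.trans hb⟩, add_assoc]
    congr 1
    unfold rampSum
    push_cast
    rw [Finset.sum_mul, ← Finset.sum_add_distrib]
    refine Finset.sum_congr rfl fun i _ => ?_
    by_cases he : ed i = e
    · rcases le_or_gt b (s i) with hb' | hb'
      · simp only [he, if_true, hb', and_self]
        rw [min_eq_left (ht.2.trans hb'), min_eq_left (hab.trans hb')]
        ring
      · have : s i ≤ a := by
          by_contra hc
          exact hS (s i) (Finset.mem_image_of_mem _ (Finset.mem_univ i)) ⟨not_le.mp hc, hb'⟩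
        simp only [he, if_true, not_le.mpr hb', and_false, if_false]
        rw [min_eq_right (this.trans ht.1), min_eq_right this]
        simp
    · simp [he]
  · intro p
    rw [hD, Finsupp.finsetSum_apply]
    push_cast
    cases p with
    | vertex v =>
      simp only [divCoeff]
      have key : ∀ e, ((if Γ.src e = v then -Γ.rightSlope f e 0 else 0) +
          (if Γ.tgt e = v then Γ.leftSlope f e (Γ.len e) else 0)) =
          ∑ i, if ed i = e then (n i : ℝ) *
            ((if Γ.edgePoint e (s i) = Point.vertex v then 1 else 0) -
              (if Γ.src e = v then 1 else 0)) else 0 := by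
        intro e
        rw [hright e 0 le_rfl (Γ.len_pos e), hleft e _ (Γ.len_pos e) le_rfl,
          ← Finset.sum_neg_distrib]
        have h2 : ∀ (P : Prop) [Decidable P] (g : ι → ℝ), (if P then ∑ i, g i else 0) =
            ∑ i, if P then g i else 0 := by
          intro P _ g; split_ifs <;> simp
        rw [h2, h2, ← Finset.sum_add_distrib]
        refine Finset.sum_congr rfl fun i _ => ?_
        by_cases he : ed i = e
        · subst he
          simp only [if_true]
          rw [edgePoint_eq_vertex_iff (hs i)]
          convert ramp_vertex_aux _ (Γ.len_pos (ed i)) (hs i) _ _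
        · simp [he]
      rw [Finset.sum_congr rfl fun e _ => key e, Finset.sum_comm]
      refine Finset.sum_congr rfl fun i _ => ?_
      rw [Finset.sum_ite_eq Finset.univ (ed i)]
      simp [Finsupp.single_apply]
    | interior e t ht =>
      simp only [divCoeff]
      rw [hright e t ht.1.le ht.2, hleft e t ht.1 ht.2.le, ← Finset.sum_sub_distrib]
      refine Finset.sum_congr rfl fun i _ => ?_
      simp only [Pi.smul_apply, Pi.sub_apply, Finsupp.single_apply, edgePoint_eq_interior_iff]
      by_cases he : ed i = e
      · rcases lt_trichotomy t (s i) with hc | hc | hc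
        · simp [he, hc, hc.le, hc.ne']
        · simp [he, hc]
        · simp [he, hc.not_gt, hc.not_ge, hc.ne]
      · simp [he]

end Ramps

/-! ### A certificate that a class contains no effective divisor -/

section Noneffective

variable {V E : Type*} {Γ : MetricGraph V E}

/-- The last point of the edge where the minimum `μ` is attained exists by compactness. The function
must rise immediately after it, and an integer slope that is positive is at least 1. -/
theorem IsRational.exists_right_exit {f : Γ.Point → ℝ} (hf : Γ.IsRational f) {μ : ℝ}
    (hμ : ∀ p, μ ≤ f p) (e : E) {t : ℝ} (h0 : 0 ≤ t) (h1 : t < Γ.len e)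
    (ht : f (Γ.edgePoint e t) = μ) (htgt : f (Point.vertex (Γ.tgt e)) ≠ μ) :
    ∃ y, t ≤ y ∧ y < Γ.len e ∧ f (Γ.edgePoint e y) = μ ∧ 1 ≤ Γ.rightSlope f e y := by
  have hcl : IsCompact {x ∈ Icc t (Γ.len e) | f (Γ.edgePoint e x) = μ} := by
    refine isCompact_Icc.of_isClosed_subset ?_ (sep_subset _ _)
    exact (((hf e).1.mono (Icc_subset_Icc_left h0)).preimage_isClosed_of_isClosed isClosed_Icc
      (isClosed_singleton (x := μ)))
  obtain ⟨y, ⟨⟨hty, hyl⟩, hy⟩, hmax⟩ := hcl.exists_isGreatest ⟨t, ⟨le_rfl, h1.le⟩, ht⟩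
  have hyl' : y < Γ.len e := by
    refine lt_of_le_of_ne hyl fun h => htgt ?_
    rw [← edgePoint_len, ← h, hy]
  refine ⟨y, hty, hyl', hy, ?_⟩
  obtain ⟨m, hm, u, hu, hul, hlin⟩ := hf.exists_right e (h0.trans hty) hyl'
  rw [rightSlope_eq hm]
  have hlu := hlin u ⟨hu.le, le_rfl⟩
  rw [hy] at hlu
  have hne : f (Γ.edgePoint e u) ≠ μ := fun h =>
    absurd (hmax ⟨⟨hty.trans hu.le, hul⟩, h⟩) (not_le.mpr hu)
  have hpos : 0 < (m : ℝ) * (u - y) := by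
    have := lt_of_le_of_ne (hμ (Γ.edgePoint e u)) hne.symm
    linarith
  have : 0 < (m : ℝ) := pos_of_mul_pos_left hpos (by linarith)
  exact_mod_cast (by exact_mod_cast this : 0 < m)

theorem IsRational.exists_left_exit {f : Γ.Point → ℝ} (hf : Γ.IsRational f) {μ : ℝ}
    (hμ : ∀ p, μ ≤ f p) (e : E) {t : ℝ} (h0 : 0 < t) (h1 : t ≤ Γ.len e)
    (ht : f (Γ.edgePoint e t) = μ) (hsrc : f (Point.vertex (Γ.src e)) ≠ μ) :
    ∃ y, y ≤ t ∧ 0 < y ∧ f (Γ.edgePoint e y) = μ ∧ Γ.leftSlope f e y ≤ -1 := by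
  have hcl : IsCompact {x ∈ Icc 0 t | f (Γ.edgePoint e x) = μ} := by
    refine isCompact_Icc.of_isClosed_subset ?_ (sep_subset _ _)
    exact (((hf e).1.mono (Icc_subset_Icc_right h1)).preimage_isClosed_of_isClosed isClosed_Icc
      (isClosed_singleton (x := μ)))
  obtain ⟨y, ⟨⟨hy0, hyt⟩, hy⟩, hmin⟩ := hcl.exists_isLeast ⟨t, ⟨h0.le, le_rfl⟩, ht⟩
  have hy0' : 0 < y := by
    refine lt_of_le_of_ne hy0 fun h => hsrc ?_
    rw [← edgePoint_zero, h, hy]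
  refine ⟨y, hyt, hy0', hy, ?_⟩
  obtain ⟨m, hm, u, hu, hul, hlin⟩ := hf.exists_left e hy0' (hyt.trans h1)
  rw [leftSlope_eq hm]
  have hlu := hlin u ⟨le_rfl, hu.le⟩
  rw [hy] at hlu
  have hne : f (Γ.edgePoint e u) ≠ μ := fun h =>
    absurd (hmin ⟨⟨hul, hu.le.trans hyt⟩, h⟩) (not_le.mpr hu)
  have hpos : 0 < (m : ℝ) * (u - y) := by
    have := lt_of_le_of_ne (hμ (Γ.edgePoint e u)) hne.symm
    linarith
  have : (m : ℝ) < 0 := by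
    by_contra hc
    push Not at hc
    nlinarith
  have : m ≤ -1 := by
    have : m < 0 := by exact_mod_cast this
    omega
  exact_mod_cast this

theorem IsRational.rightSlope_nonneg {f : Γ.Point → ℝ} (hf : Γ.IsRational f) {μ : ℝ}
    (hμ : ∀ p, μ ≤ f p) (e : E) {t : ℝ} (h0 : 0 ≤ t) (h1 : t < Γ.len e)
    (ht : f (Γ.edgePoint e t) = μ) : 0 ≤ Γ.rightSlope f e t := by
  obtain ⟨m, hm, u, hu, -, hlin⟩ := hf.exists_right e h0 h1
  rw [rightSlope_eq hm]
  have hlu := hlin u ⟨hu.le, le_rfl⟩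
  have := hμ (Γ.edgePoint e u)
  by_contra hc
  push Not at hc
  nlinarith

theorem IsRational.leftSlope_nonpos {f : Γ.Point → ℝ} (hf : Γ.IsRational f) {μ : ℝ}
    (hμ : ∀ p, μ ≤ f p) (e : E) {t : ℝ} (h0 : 0 < t) (h1 : t ≤ Γ.len e)
    (ht : f (Γ.edgePoint e t) = μ) : Γ.leftSlope f e t ≤ 0 := by
  obtain ⟨m, hm, u, hu, -, hlin⟩ := hf.exists_left e h0 h1
  rw [leftSlope_eq hm]
  have hlu := hlin u ⟨le_rfl, hu.le⟩
  have := hμ (Γ.edgePoint e u)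
  by_contra hc
  push Not at hc
  nlinarith

/-- Put one chip on every closed edge, away from the endpoint that comes first in the order `π`, and
take one chip from every vertex.  The resulting divisor is not equivalent to an effective one. -/
theorem linearSystem_eq_empty_of_le [Fintype V] [Nonempty V] [Fintype E] (π : V → ℕ)
    (hπ : ∀ e, π (Γ.src e) ≠ π (Γ.tgt e)) (x : E → ℝ) (hx : ∀ e, x e ∈ Icc 0 (Γ.len e))
    (hx0 : ∀ e, π (Γ.src e) < π (Γ.tgt e) → x e ≠ 0)
    (hx1 : ∀ e, π (Γ.tgt e) < π (Γ.src e) → x e ≠ Γ.len e) {D : Γ.Point →₀ ℤ}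
    (hD : D ≤ ∑ e, Finsupp.single (Γ.edgePoint e (x e)) 1 -
      ∑ v, Finsupp.single (Point.vertex v) 1) :
    linearSystem Γ.LinEquiv D = ∅ := by
  classical
  rw [Set.eq_empty_iff_forall_notMem]
  rintro A ⟨hA, f, hf, hfd⟩
  have hint : ∀ e t (_ : t ∈ Ioo 0 (Γ.len e)), 0 ≤ (if x e = t then 1 else 0) +
      (Γ.leftSlope f e t - Γ.rightSlope f e t) := by
    intro e t ht
    have h1 := hfd (Point.interior e t ht)
    have h2 := hD (Point.interior e t ht)
    have h3 := hA (Point.interior e t ht)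
    have h4 : D (Point.interior e t ht) ≤ if x e = t then 1 else 0 := by
      refine h2.trans (le_of_eq ?_)
      simp only [Finsupp.sub_apply, Finsupp.finsetSum_apply, Finsupp.single_apply,
        edgePoint_eq_interior_iff]
      simp [ite_and]
    simp only [divCoeff] at h1
    rw [← h1]
    have h5 : (0 : ℤ) ≤ (if x e = t then 1 else 0) + (A - D) (Point.interior e t ht) := by
      simp only [Finsupp.sub_apply, Finsupp.coe_zero, Pi.zero_apply] at h3 ⊢
      linarith
    exact_mod_cast h5
  have hver : ∀ v, 0 ≤ ∑ e, ((if Γ.edgePoint e (x e) = Point.vertex v then (1 : ℝ) else 0) +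
      ((if Γ.src e = v then -Γ.rightSlope f e 0 else 0) +
        (if Γ.tgt e = v then Γ.leftSlope f e (Γ.len e) else 0))) - 1 := by
    intro v
    have h1 := hfd (Point.vertex v)
    have h2 := hD (Point.vertex v)
    have h3 := hA (Point.vertex v)
    simp only [divCoeff] at h1
    rw [Finset.sum_add_distrib, ← h1]
    have h4 : D (Point.vertex v) ≤
        ∑ e, (if Γ.edgePoint e (x e) = Point.vertex v then (1 : ℤ) else 0) - 1 := by
      refine h2.trans (le_of_eq ?_)
      simp only [Finsupp.sub_apply, Finsupp.finsetSum_apply, Finsupp.single_apply]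
      simp
    have h5 : (0 : ℤ) ≤ ∑ e, (if Γ.edgePoint e (x e) = Point.vertex v then (1 : ℤ) else 0) +
        (A - D) (Point.vertex v) - 1 := by
      simp only [Finsupp.sub_apply, Finsupp.coe_zero, Pi.zero_apply] at h3 ⊢
      linarith
    exact_mod_cast h5
  obtain ⟨p₀, hp₀⟩ : ∃ p₀, ∀ p, f p₀ ≤ f p := by
    have hex : ∀ e, ∃ t ∈ Icc 0 (Γ.len e), ∀ t' ∈ Icc 0 (Γ.len e),
        f (Γ.edgePoint e t) ≤ f (Γ.edgePoint e t') := fun e =>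
      isCompact_Icc.exists_isMinOn (nonempty_Icc.mpr (Γ.len_pos e).le) (hf e).1
    choose t ht htmin using hex
    obtain ⟨i, hi⟩ := Finite.exists_min (fun i : V ⊕ E =>
      f (Sum.elim Point.vertex (fun e => Γ.edgePoint e (t e)) i))
    refine ⟨Sum.elim Point.vertex (fun e => Γ.edgePoint e (t e)) i, fun p => ?_⟩
    cases p with
    | vertex v => exact hi (Sum.inl v)
    | interior e s hs =>
      refine (hi (Sum.inr e)).trans ?_
      rw [← edgePoint_interior e hs]
      exact htmin e s ⟨hs.1.le, hs.2.le⟩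
  set μ := f p₀ with hμdef
  by_cases hvex : ∃ v, f (Point.vertex v) = μ
  -- `v` is the first vertex, in the order `π`, of the minimum set. Each edge contributes at most 0
  -- to its coefficient, counting the edge chip, so the chip taken from `v` leaves a negative total.
  · obtain ⟨v, hv, hvmin⟩ := exists_min_image {v : V | f (Point.vertex v) = μ} π (toFinite _) hvex
    have hv' : f (Point.vertex v) = μ := hv
    refine absurd (hver v) (not_le.mpr ?_)
    suffices hle : ∀ e, (if Γ.edgePoint e (x e) = Point.vertex v then (1 : ℝ) else 0) +
      ((if Γ.src e = v then -Γ.rightSlope f e 0 else 0) +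
        (if Γ.tgt e = v then Γ.leftSlope f e (Γ.len e) else 0)) ≤ 0 by
      linarith [Finset.sum_nonpos fun e (_ : e ∈ Finset.univ) => hle e]
    intro e
    have hne : Γ.src e ≠ Γ.tgt e := fun h => hπ e (by rw [h])
    by_cases hs : Γ.src e = v
    · have ht : Γ.tgt e ≠ v := fun h => hne (hs.trans h.symm)
      have hμ0 : f (Γ.edgePoint e 0) = μ := by rw [edgePoint_zero, hs, hv']
      have hr := hf.rightSlope_nonneg hp₀ e le_rfl (Γ.len_pos e) hμ0
      by_cases hxe : Γ.edgePoint e (x e) = Point.vertex v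
      -- The chip of `e` sits at `v`, so the other endpoint is earlier and lies outside the minimum
      -- set. Leaving that set at an interior point would need a chip there, so `f` already rises at
      -- `v`, which cancels the chip.
      · have hxe' := (edgePoint_eq_vertex_iff (hx e)).mp hxe
        simp only [ht, and_false, or_false] at hxe'
        have hπe : π (Γ.tgt e) < π (Γ.src e) :=
          lt_of_le_of_ne (not_lt.mp fun h => hx0 e h hxe'.1) (hπ e).symm
        have htgt : f (Point.vertex (Γ.tgt e)) ≠ μ := fun h =>
          absurd (hvmin _ h) (by rw [← hs]; exact not_le.mpr hπe)
        obtain ⟨y, hy0, hyl, hyμ, hy⟩ :=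
          hf.exists_right_exit hp₀ e le_rfl (Γ.len_pos e) hμ0 htgt
        have hy0' : y = 0 := by
          by_contra hc
          have hy0 := lt_of_le_of_ne hy0 (Ne.symm hc)
          have h6 := hint e y ⟨hy0, hyl⟩
          have h7 := hf.leftSlope_nonpos hp₀ e hy0 hyl.le hyμ
          rw [if_neg (by rw [hxe'.1]; exact hy0.ne)] at h6
          linarith
        rw [hy0'] at hy
        rw [if_pos hxe, if_pos hs, if_neg ht]
        linarith
      · rw [if_neg hxe, if_pos hs, if_neg ht]
        linarith
    · by_cases ht : Γ.tgt e = v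
      · have hμ1 : f (Γ.edgePoint e (Γ.len e)) = μ := by rw [edgePoint_len, ht, hv']
        have hl := hf.leftSlope_nonpos hp₀ e (Γ.len_pos e) le_rfl hμ1
        by_cases hxe : Γ.edgePoint e (x e) = Point.vertex v
        · have hxe' := (edgePoint_eq_vertex_iff (hx e)).mp hxe
          simp only [hs, and_false, false_or] at hxe'
          have hπe : π (Γ.src e) < π (Γ.tgt e) :=
            lt_of_le_of_ne (not_lt.mp fun h => hx1 e h hxe'.1) (hπ e)
          have hsrc : f (Point.vertex (Γ.src e)) ≠ μ := fun h =>
            absurd (hvmin _ h) (by rw [← ht]; exact not_le.mpr hπe)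
          obtain ⟨y, hyl, hy0, hyμ, hy⟩ :=
            hf.exists_left_exit hp₀ e (Γ.len_pos e) le_rfl hμ1 hsrc
          have hyl' : y = Γ.len e := by
            by_contra hc
            have hyl := lt_of_le_of_ne hyl hc
            have h6 := hint e y ⟨hy0, hyl⟩
            have h7 := hf.rightSlope_nonneg hp₀ e hy0.le hyl hyμ
            rw [if_neg (by rw [hxe'.1]; exact hyl.ne')] at h6
            linarith
          rw [hyl'] at hy
          rw [if_pos hxe, if_neg hs, if_pos ht]
          linarith
        · rw [if_neg hxe, if_neg hs, if_pos ht]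
          linarith
      · have hxe : Γ.edgePoint e (x e) ≠ Point.vertex v := by
          rw [Ne, edgePoint_eq_vertex_iff (hx e)]
          tauto
        rw [if_neg hxe, if_neg hs, if_neg ht]
        simp
  -- With no vertex in the minimum set, `f` leaves it on both sides within one edge. Both exits need
  -- the only chip of that edge, so they coincide, and one chip cannot pay for two unit slopes.
  · push Not at hvex
    have hpi : ∃ e t, t ∈ Ioo 0 (Γ.len e) ∧ f (Γ.edgePoint e t) = μ := by
      cases hp : p₀ with
      | vertex v => exact absurd (by rw [hμdef, hp]) (hvex v)
      | interior e t ht => exact ⟨e, t, ht, by rw [edgePoint_interior e ht, hμdef, hp]⟩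
    obtain ⟨e, t, ht, hμt⟩ := hpi
    obtain ⟨y, hty, hyl, hyμ, hy⟩ := hf.exists_right_exit hp₀ e ht.1.le ht.2 hμt (hvex _)
    obtain ⟨y', hyt', hy0', hyμ', hy'⟩ := hf.exists_left_exit hp₀ e ht.1 ht.2.le hμt (hvex _)
    have h1 := hint e y ⟨ht.1.trans_le hty, hyl⟩
    have h2 := hint e y' ⟨hy0', hyt'.trans_lt ht.2⟩
    have h3 := hf.leftSlope_nonpos hp₀ e (ht.1.trans_le hty) hyl.le hyμ
    have h4 := hf.rightSlope_nonneg hp₀ e hy0'.le (hyt'.trans_lt ht.2) hyμ'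
    have hxy : x e = y := by
      by_contra hc
      rw [if_neg hc] at h1
      linarith
    have hxy' : x e = y' := by
      by_contra hc
      rw [if_neg hc] at h2
      linarith
    have hyy : y' = y := hxy'.symm.trans hxy
    rw [hyy] at hy'
    rw [if_pos hxy] at h1
    linarith

end Noneffective

end MetricGraph

end

section

open Set Filter Topology

/-! ### Degrees of divisors -/

section Degree

variable {P Q : Type*}

theorem divisorDegree_add (D D' : P →₀ ℤ) :
    divisorDegree (D + D') = divisorDegree D + divisorDegree D' :=
  Finsupp.sum_add_index' (fun _ => rfl) fun _ _ _ => rfl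

theorem divisorDegree_single (p : P) (n : ℤ) : divisorDegree (Finsupp.single p n) = n := by
  simp [divisorDegree]

theorem divisorDegree_zero : divisorDegree (0 : P →₀ ℤ) = 0 := by
  simp [divisorDegree]

theorem divisorDegree_neg (D : P →₀ ℤ) : divisorDegree (-D) = -divisorDegree D := by
  have h := divisorDegree_add D (-D)
  rw [add_neg_cancel, divisorDegree_zero] at h
  linarith

theorem divisorDegree_sub (D D' : P →₀ ℤ) :
    divisorDegree (D - D') = divisorDegree D - divisorDegree D' := by
  rw [sub_eq_add_neg, divisorDegree_add, divisorDegree_neg, sub_eq_add_neg]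

theorem divisorDegree_smul (n : ℤ) (D : P →₀ ℤ) :
    divisorDegree (n • D) = n * divisorDegree D := by
  rw [divisorDegree, Finsupp.sum_smul_index' (fun _ => rfl), divisorDegree, Finsupp.mul_sum]
  rfl

theorem divisorDegree_sum {ι : Type*} (s : Finset ι) (D : ι → P →₀ ℤ) :
    divisorDegree (∑ i ∈ s, D i) = ∑ i ∈ s, divisorDegree (D i) := by
  classical
  induction s using Finset.induction_on with
  | empty => simp [divisorDegree_zero]
  | insert i s hi ih => rw [Finset.sum_insert hi, Finset.sum_insert hi, divisorDegree_add, ih]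

theorem divisorDegree_mapDomain (φ : P → Q) (D : P →₀ ℤ) :
    divisorDegree (D.mapDomain φ) = divisorDegree D :=
  Finsupp.sum_mapDomain_index (fun _ => rfl) fun _ _ _ => rfl

theorem divisorDegree_eq_sum [Fintype P] (D : P →₀ ℤ) : divisorDegree D = ∑ p, D p :=
  Finsupp.sum_fintype _ _ fun _ => rfl

end Degree

namespace MetricGraph

/-! ### Normal form: vertex coefficients and one chip of real position on each edge -/

section Chips

variable {V E : Type*} {Γ : MetricGraph V E}

theorem vertex_injective : Function.Injective (Point.vertex : V → Γ.Point) :=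
  fun _ _ h => by injection h

variable (Γ) in
/-- The divisor on a metric graph defined by a divisor on its set of vertices. -/
noncomputable def vertexDivisor (A : V →₀ ℤ) : Γ.Point →₀ ℤ := A.mapDomain Point.vertex

theorem vertexDivisor_add (A B : V →₀ ℤ) :
    Γ.vertexDivisor (A + B) = Γ.vertexDivisor A + Γ.vertexDivisor B :=
  Finsupp.mapDomain_add

theorem vertexDivisor_sub (A B : V →₀ ℤ) :
    Γ.vertexDivisor (A - B) = Γ.vertexDivisor A - Γ.vertexDivisor B := by
  rw [eq_sub_iff_add_eq, ← vertexDivisor_add, sub_add_cancel]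

theorem vertexDivisor_zero : Γ.vertexDivisor 0 = 0 := Finsupp.mapDomain_zero

theorem vertexDivisor_single (v : V) (n : ℤ) :
    Γ.vertexDivisor (Finsupp.single v n) = Finsupp.single (Point.vertex v) n :=
  Finsupp.mapDomain_single

theorem vertexDivisor_smul (n : ℤ) (A : V →₀ ℤ) :
    Γ.vertexDivisor (n • A) = n • Γ.vertexDivisor A :=
  Finsupp.mapDomain_smul n A

theorem vertexDivisor_sum {ι : Type*} (s : Finset ι) (A : ι → V →₀ ℤ) :
    Γ.vertexDivisor (∑ i ∈ s, A i) = ∑ i ∈ s, Γ.vertexDivisor (A i) :=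
  Finsupp.mapDomain_finsetSum

theorem vertexDivisor_vertex (A : V →₀ ℤ) (v : V) :
    Γ.vertexDivisor A (Point.vertex v) = A v :=
  Finsupp.mapDomain_apply vertex_injective _ _

theorem vertexDivisor_interior (A : V →₀ ℤ) (e : E) (t : ℝ) (ht : t ∈ Ioo 0 (Γ.len e)) :
    Γ.vertexDivisor A (Point.interior e t ht) = 0 :=
  Finsupp.mapDomain_of_notMem_range _ _ (by rintro ⟨v, hv⟩; cases hv)

theorem vertexDivisor_mono {A B : V →₀ ℤ} (h : A ≤ B) :
    Γ.vertexDivisor A ≤ Γ.vertexDivisor B := by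
  intro p
  cases p with
  | vertex v => simpa only [vertexDivisor_vertex] using h v
  | interior e t ht => simp only [vertexDivisor_interior, le_refl]

theorem divisorDegree_vertexDivisor (A : V →₀ ℤ) :
    divisorDegree (Γ.vertexDivisor A) = divisorDegree A :=
  divisorDegree_mapDomain _ _

variable (Γ) in
/-- A chip on the edge `e` (of length `1`) moved to the real position `y`: for `y` outside of
`[0, 1]`, chips are transported along the whole edge. -/
noncomputable def edgeChip (e : E) (y : ℝ) : Γ.Point →₀ ℤ :=
  ⌊y⌋ • (Finsupp.single (Point.vertex (Γ.tgt e)) 1 - Finsupp.single (Point.vertex (Γ.src e)) 1) +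
    Finsupp.single (Γ.edgePoint e (Int.fract y)) 1

theorem edgeChip_of_mem_Ico (e : E) {y : ℝ} (hy : y ∈ Ico 0 1) :
    Γ.edgeChip e y = Finsupp.single (Γ.edgePoint e y) 1 := by
  rw [edgeChip, Int.floor_eq_zero_iff.mpr hy, Int.fract_eq_self.mpr hy]
  simp

/-- At an integer position the chip is a vertex, and there are two admissible choices of `n`. This
freedom lets an order on the vertices decide which endpoint the leftover chip may occupy. -/
theorem edgeChip_eq (hlen : ∀ e, Γ.len e = 1) (e : E) {y : ℝ} {n : ℤ} (hy : y - n ∈ Icc 0 1) :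
    Γ.edgeChip e y =
      n • (Finsupp.single (Point.vertex (Γ.tgt e)) 1 -
        Finsupp.single (Point.vertex (Γ.src e)) 1) +
      Finsupp.single (Γ.edgePoint e (y - n)) 1 := by
  rcases hy.2.eq_or_lt with h | h
  · obtain rfl : y = (n + 1 : ℤ) := by push_cast; linarith
    rw [edgeChip, Int.floor_intCast, Int.fract_intCast, h, edgePoint_zero, ← hlen e,
      edgePoint_len, add_smul]
    simp only [one_smul]
    abel
  · have hfl : ⌊y⌋ = n := by
      rw [Int.floor_eq_iff]
      constructor <;> linarith [hy.1]
    rw [edgeChip, Int.fract, hfl]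

/-- The two floors add up to 1 when the chip is at a vertex and to 0 when it is interior. In the
second case the interior chip itself is the surplus. -/
theorem edgeChip_ge (e : E) (y : ℝ) :
    Γ.vertexDivisor (Finsupp.single (Γ.tgt e) ⌊y⌋ + Finsupp.single (Γ.src e) ⌊1 - y⌋) ≤
      Γ.edgeChip e y := by
  classical
  rw [vertexDivisor_add, vertexDivisor_single, vertexDivisor_single, edgeChip]
  by_cases h : Int.fract y = 0
  · have h1 : ⌊1 - y⌋ = 1 - ⌊y⌋ := by
      have : y = ⌊y⌋ := by linarith [Int.floor_add_fract y]
      rw [this]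
      norm_cast
      rw [Int.floor_intCast, Int.floor_intCast]
    rw [h, edgePoint_zero, h1]
    intro p
    simp only [Finsupp.coe_add, Finsupp.coe_smul, Finsupp.coe_sub, Pi.add_apply, Pi.smul_apply,
      Pi.sub_apply, Finsupp.single_apply, smul_eq_mul]
    split_ifs <;> linarith
  · have h1 : ⌊1 - y⌋ = -⌊y⌋ := by
      rw [Int.floor_eq_iff]
      have h2 := Int.floor_add_fract y
      have h3 := Int.fract_lt_one y
      have h4 := lt_of_le_of_ne (Int.fract_nonneg y) (Ne.symm h)
      push_cast
      constructor <;> linarith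
    rw [h1]
    intro p
    simp only [Finsupp.coe_add, Finsupp.coe_smul, Finsupp.coe_sub, Pi.add_apply, Pi.smul_apply,
      Pi.sub_apply, Finsupp.single_apply, smul_eq_mul]
    split_ifs <;> linarith

theorem divisorDegree_edgeChip (e : E) (y : ℝ) : divisorDegree (Γ.edgeChip e y) = 1 := by
  simp [edgeChip, divisorDegree_add, divisorDegree_smul, divisorDegree_sub, divisorDegree_single]

/-- A chip at position `y` is a ramp up to the fractional part of `y` plus a full-length ramp of
slope multiplied by `⌊y⌋`. The total rise is `n i * y i`, so the matching condition is linear in the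
positions. -/
theorem linEquiv_of_edgeChips [Fintype E] [DecidableEq E] (hlen : ∀ e, Γ.len e = 1)
    {ι : Type*} [Fintype ι] (ed : ι → E) (y : ι → ℝ) (n : ι → ℤ) (h : V → ℝ)
    (hh : ∀ e, (∑ i, if ed i = e then n i * y i else 0) = h (Γ.tgt e) - h (Γ.src e))
    {D₁ D₂ : Γ.Point →₀ ℤ}
    (hD : D₁ - D₂ = ∑ i, n i • (Γ.edgeChip (ed i) (y i) -
      Finsupp.single (Point.vertex (Γ.src (ed i))) 1)) : Γ.LinEquiv D₁ D₂ := by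
  refine linEquiv_of_ramps (Sum.elim ed ed) (Sum.elim (fun i => Int.fract (y i)) fun _ => 1)
    ?_ (Sum.elim n fun i => n i * ⌊y i⌋) h (fun e => ?_) ?_
  · rintro (i | i)
    · simp only [Sum.elim_inl, hlen]
      exact ⟨Int.fract_nonneg _, (Int.fract_lt_one _).le⟩
    · simp [hlen]
  · rw [← hh, rampSum, Fintype.sum_sum_type, ← Finset.sum_add_distrib, hlen]
    refine Finset.sum_congr rfl fun i _ => ?_
    by_cases he : ed i = e
    · simp only [Sum.elim_inl, Sum.elim_inr, he, if_true]
      rw [min_eq_right (Int.fract_lt_one _).le]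
      push_cast
      rw [min_self]
      nth_rewrite 3 [← Int.floor_add_fract (y i)]
      ring
    · simp [he]
  · rw [hD, Fintype.sum_sum_type, ← Finset.sum_add_distrib]
    refine Finset.sum_congr rfl fun i _ => ?_
    simp only [Sum.elim_inl, Sum.elim_inr, edgeChip]
    have : Γ.edgePoint (ed i) 1 = Point.vertex (Γ.tgt (ed i)) := by
      rw [← hlen (ed i), edgePoint_len]
    rw [this, mul_smul, ← smul_add]
    congr 1
    abel

variable (Γ) in
/-- The divisor with coefficients `A` at the vertices, and one chip on every edge, moved to the real
position `y e`. -/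
noncomputable def chipDivisor [Fintype E] (A : V →₀ ℤ) (y : E → ℝ) : Γ.Point →₀ ℤ :=
  Γ.vertexDivisor A + ∑ e, Γ.edgeChip e (y e)

theorem chipDivisor_add [Fintype E] (A B : V →₀ ℤ) (y : E → ℝ) :
    Γ.chipDivisor (A + B) y = Γ.chipDivisor A y + Γ.vertexDivisor B := by
  rw [chipDivisor, chipDivisor, vertexDivisor_add]
  abel

theorem chipDivisor_sub [Fintype E] (A B : V →₀ ℤ) (y : E → ℝ) :
    Γ.chipDivisor (A - B) y = Γ.chipDivisor A y - Γ.vertexDivisor B := by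
  rw [chipDivisor, chipDivisor, vertexDivisor_sub]
  abel

theorem divisorDegree_chipDivisor [Fintype E] (A : V →₀ ℤ) (y : E → ℝ) :
    divisorDegree (Γ.chipDivisor A y) = divisorDegree A + Fintype.card E := by
  simp [chipDivisor, divisorDegree_add, divisorDegree_vertexDivisor, divisorDegree_sum,
    divisorDegree_edgeChip]

/-- Firing by a real potential: remove the old chips and insert the new ones. The net rise along an
edge is the potential difference required by `linEquiv_of_edgeChips`. -/
theorem linEquiv_chipDivisor_shift [Fintype E] (hlen : ∀ e, Γ.len e = 1) (A : V →₀ ℤ)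
    (y : E → ℝ) (h : V → ℝ) :
    Γ.LinEquiv (Γ.chipDivisor A y)
      (Γ.chipDivisor A fun e => y e + (h (Γ.src e) - h (Γ.tgt e))) := by
  classical
  refine linEquiv_of_edgeChips hlen (ι := E ⊕ E) (Sum.elim id id)
    (Sum.elim y fun e => y e + (h (Γ.src e) - h (Γ.tgt e))) (Sum.elim (fun _ => 1) fun _ => -1) h
    (fun e => ?_) ?_
  · simp [Fintype.sum_sum_type]
  · simp only [Fintype.sum_sum_type, Sum.elim_inl, Sum.elim_inr, ← Finset.sum_add_distrib,
      chipDivisor, add_sub_add_left_eq_sub, ← Finset.sum_sub_distrib]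
    refine Finset.sum_congr rfl fun e _ => ?_
    simp only [id, one_smul, neg_smul]
    abel

/-- Chips on one edge may be exchanged when their positions have the same sum: those at `t` and `y
e` become those at 0 and `y e + t`. -/
theorem linEquiv_single_add_chipDivisor [Fintype E] [DecidableEq E] (hlen : ∀ e, Γ.len e = 1)
    (A : V →₀ ℤ) (y : E → ℝ) (e : E) {t : ℝ} (ht : t ∈ Ioo 0 (Γ.len e)) :
    Γ.LinEquiv (Finsupp.single (Point.interior e t ht) 1 + Γ.chipDivisor A y)
      (Γ.chipDivisor (A + Finsupp.single (Γ.src e) 1) (Function.update y e (y e + t))) := by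
  have ht' : t ∈ Ico (0 : ℝ) 1 := ⟨ht.1.le, by simpa [hlen] using ht.2⟩
  refine linEquiv_of_edgeChips hlen (ι := Fin 3) (fun _ => e) ![t, y e, y e + t] ![1, 1, -1] 0
    (fun e' => ?_) ?_
  · simp only [Fin.sum_univ_three]
    split_ifs
    · simp
      ring
    · simp
  · have hsum : ∑ e', Γ.edgeChip e' (Function.update y e (y e + t) e') =
        ∑ e', Γ.edgeChip e' (y e') - Γ.edgeChip e (y e) + Γ.edgeChip e (y e + t) := by
      rw [← Finset.add_sum_erase _ _ (Finset.mem_univ e),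
        ← Finset.add_sum_erase Finset.univ (fun e' => Γ.edgeChip e' (y e')) (Finset.mem_univ e),
        Finset.sum_congr rfl fun e' he' => by
          rw [Function.update_of_ne (Finset.ne_of_mem_erase he')]]
      simp only [Function.update_self]
      abel
    simp only [Fin.sum_univ_three, chipDivisor, hsum, vertexDivisor_add, vertexDivisor_single]
    simp only [Matrix.cons_val_zero, Matrix.cons_val_one, Matrix.cons_val, one_smul, neg_smul]
    rw [edgeChip_of_mem_Ico e ht', edgePoint_interior e ht]
    abel

theorem linearSystem_eq_empty_of_linEquiv [Fintype E] {D D' : Γ.Point →₀ ℤ}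
    (h : Γ.LinEquiv D D') (h' : linearSystem Γ.LinEquiv D' = ∅) :
    linearSystem Γ.LinEquiv D = ∅ := by
  rw [Set.eq_empty_iff_forall_notMem] at h' ⊢
  exact fun A hA => h' A ⟨hA.1, hA.2.trans h⟩

theorem LinEquiv.refl [Fintype E] (D : Γ.Point →₀ ℤ) : Γ.LinEquiv D D := by
  classical
  exact linEquiv_of_ramps (ι := Empty) Empty.elim Empty.elim (fun i => i.elim) Empty.elim 0
    (by simp [rampSum]) (by simp)

theorem IsRational.neg {f : Γ.Point → ℝ} (hf : Γ.IsRational f) : Γ.IsRational (-f) := by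
  intro e
  obtain ⟨hc, S, hS⟩ := hf e
  refine ⟨hc.neg, S, fun a b ha hab hb h => ?_⟩
  obtain ⟨m, hm⟩ := hS a b ha hab hb h
  refine ⟨-m, fun t ht => ?_⟩
  simp only [Pi.neg_apply, hm t ht]
  push_cast
  ring

theorem LinEquiv.symm [Fintype E] {D₁ D₂ : Γ.Point →₀ ℤ} (h : Γ.LinEquiv D₁ D₂) :
    Γ.LinEquiv D₂ D₁ := by
  obtain ⟨f, hf, hfd⟩ := h
  -- Any rational `g` will do here: additivity applied to `0 + g` gives div 0 = 0.
  obtain ⟨g, hg, hgd⟩ := LinEquiv.refl (0 : Γ.Point →₀ ℤ)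
  refine ⟨-f, hf.neg, fun p => ?_⟩
  have h0 : Γ.divCoeff (f + -f) p = 0 := by
    rw [add_neg_cancel]
    have h1 : (0 : Γ.Point → ℝ) + g = g := zero_add g
    have hz : Γ.IsRational (0 : Γ.Point → ℝ) := by
      have := hf.add hf.neg
      rwa [add_neg_cancel] at this
    have h2 := hz.divCoeff_add hg p
    rw [h1] at h2
    linarith
  rw [hf.divCoeff_add hf.neg, ← hfd] at h0
  push_cast [Finsupp.sub_apply] at h0 ⊢
  linarith

theorem exists_linEquiv_chipDivisor [Fintype E] (hlen : ∀ e, Γ.len e = 1) (D : Γ.Point →₀ ℤ) :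
    ∃ A y, Γ.LinEquiv D (Γ.chipDivisor A y) ∧
      divisorDegree D = divisorDegree (Γ.chipDivisor A y) := by
  classical
  suffices H : ∀ A y, ∃ A' y', Γ.LinEquiv (D + Γ.chipDivisor A y) (Γ.chipDivisor A' y') ∧
      divisorDegree (D + Γ.chipDivisor A y) = divisorDegree (Γ.chipDivisor A' y') by
    -- The zero divisor is in normal form: every edge chip lies at its source and is cancelled
    -- there.
    have h0 : Γ.chipDivisor (-∑ e, Finsupp.single (Γ.src e) 1) 0 = 0 := by
      rw [chipDivisor, ← zero_sub, vertexDivisor_sub, vertexDivisor_zero, vertexDivisor_sum,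
        zero_sub, neg_add_eq_zero]
      refine Finset.sum_congr rfl fun e _ => ?_
      rw [vertexDivisor_single, Pi.zero_apply, edgeChip_of_mem_Ico e (by simp), edgePoint_zero]
    simpa only [h0, add_zero] using H (-∑ e, Finsupp.single (Γ.src e) 1) 0
  have hadd : ∀ D₁ D₂ : Γ.Point →₀ ℤ,
      (∀ A y, ∃ A' y', Γ.LinEquiv (D₁ + Γ.chipDivisor A y) (Γ.chipDivisor A' y') ∧
        divisorDegree (D₁ + Γ.chipDivisor A y) = divisorDegree (Γ.chipDivisor A' y')) →
      (∀ A y, ∃ A' y', Γ.LinEquiv (D₂ + Γ.chipDivisor A y) (Γ.chipDivisor A' y') ∧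
        divisorDegree (D₂ + Γ.chipDivisor A y) = divisorDegree (Γ.chipDivisor A' y')) →
      ∀ A y, ∃ A' y', Γ.LinEquiv (D₁ + D₂ + Γ.chipDivisor A y) (Γ.chipDivisor A' y') ∧
        divisorDegree (D₁ + D₂ + Γ.chipDivisor A y) = divisorDegree (Γ.chipDivisor A' y') := by
    intro D₁ D₂ h₁ h₂ A y
    obtain ⟨A₁, y₁, e₁, d₁⟩ := h₁ A y
    obtain ⟨A₂, y₂, e₂, d₂⟩ := h₂ A₁ y₁
    refine ⟨A₂, y₂, ?_, ?_⟩
    · refine LinEquiv.trans ?_ e₂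
      rw [add_assoc, add_left_comm, add_comm D₂ (Γ.chipDivisor A₁ y₁), add_comm D₂]
      exact e₁.add_right D₂
    · rw [← d₂, divisorDegree_add D₂, ← d₁]
      simp only [divisorDegree_add]
      ring
  induction D using Finsupp.induction_linear with
  | zero => exact fun A y => ⟨A, y, by simpa using LinEquiv.refl _, by simp⟩
  | add D₁ D₂ h₁ h₂ => exact hadd D₁ D₂ h₁ h₂
  | single p n =>
    have hpm : (∀ A y, ∃ A' y', Γ.LinEquiv (Finsupp.single p 1 + Γ.chipDivisor A y)
          (Γ.chipDivisor A' y') ∧ divisorDegree (Finsupp.single p 1 + Γ.chipDivisor A y) =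
          divisorDegree (Γ.chipDivisor A' y')) ∧
        (∀ A y, ∃ A' y', Γ.LinEquiv (Finsupp.single p (-1) + Γ.chipDivisor A y)
          (Γ.chipDivisor A' y') ∧ divisorDegree (Finsupp.single p (-1) + Γ.chipDivisor A y) =
          divisorDegree (Γ.chipDivisor A' y')) := by
      cases p with
      | vertex v =>
        have hv : ∀ (n : ℤ) A y, Finsupp.single (Point.vertex v) n + Γ.chipDivisor A y =
            Γ.chipDivisor (A + Finsupp.single v n) y := by
          intro n A y
          rw [chipDivisor_add, vertexDivisor_single, add_comm]
        constructor
        · intro A y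
          exact ⟨_, y, by rw [hv]; exact LinEquiv.refl _, by rw [hv]⟩
        · intro A y
          exact ⟨_, y, by rw [hv]; exact LinEquiv.refl _, by rw [hv]⟩
      | interior e t ht =>
        constructor
        · intro A y
          refine ⟨_, _, linEquiv_single_add_chipDivisor hlen A y e ht, ?_⟩
          simp only [divisorDegree_add, divisorDegree_chipDivisor, divisorDegree_single]
          ring
        · intro A y
          have h1 := linEquiv_single_add_chipDivisor hlen (A - Finsupp.single (Γ.src e) 1)
            (Function.update y e (y e - t)) e ht
          rw [sub_add_cancel, Function.update_self, Function.update_idem, sub_add_cancel,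
            Function.update_eq_self] at h1
          refine ⟨A - Finsupp.single (Γ.src e) 1, Function.update y e (y e - t), ?_, ?_⟩
          · have h2 := (h1.add_right (Finsupp.single (Point.interior e t ht) (-1))).symm
            rw [add_comm (Finsupp.single (Point.interior e t ht) (1 : ℤ)), add_assoc,
              ← Finsupp.single_add] at h2
            simpa [add_comm] using h2
          · simp only [divisorDegree_add, divisorDegree_chipDivisor, divisorDegree_single,
              divisorDegree_sub]
            ring
    induction n with
    | zero =>
      intro A y
      exact ⟨A, y, by simpa using LinEquiv.refl _, by simp⟩
    | succ n ih =>
      rw [Finsupp.single_add]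
      exact hadd _ _ ih hpm.1
    | pred n ih =>
      rw [sub_eq_add_neg, Finsupp.single_add]
      exact hadd _ _ ih hpm.2

/-- `n e` is the integer part chosen so that the leftover chip avoids the earlier endpoint: with the
ceiling the remainder is positive, with the floor it is less than 1. -/
theorem linearSystem_chipDivisor_eq_empty [Fintype V] [Nonempty V] [Fintype E]
    (hlen : ∀ e, Γ.len e = 1) (π : V → ℕ) (hπ : ∀ e, π (Γ.src e) ≠ π (Γ.tgt e))
    (A : V →₀ ℤ) (y : E → ℝ) (n : E → ℤ)
    (hn : ∀ e, n e = if π (Γ.src e) < π (Γ.tgt e) then ⌈y e⌉ - 1 else ⌊y e⌋)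
    (hA : ∀ v, (A + ∑ e, n e • (Finsupp.single (Γ.tgt e) 1 - Finsupp.single (Γ.src e) 1)) v ≤ -1) :
    linearSystem Γ.LinEquiv (Γ.chipDivisor A y) = ∅ := by
  have hmem : ∀ e, y e - n e ∈ Icc (0 : ℝ) 1 := by
    intro e
    rw [hn]
    split_ifs
    · push_cast
      constructor <;> linarith [Int.le_ceil (y e), Int.ceil_lt_add_one (y e)]
    · constructor <;> linarith [Int.floor_le (y e), Int.lt_floor_add_one (y e)]
  refine linearSystem_eq_empty_of_le π hπ (fun e => y e - n e)
    (fun e => by simpa [hlen] using hmem e) (fun e he => ?_) (fun e he => ?_) ?_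
  · rw [hn, if_pos he]
    push_cast
    linarith [Int.ceil_lt_add_one (y e)]
  · rw [hn, if_neg he.not_gt, hlen]
    linarith [Int.lt_floor_add_one (y e)]
  · rw [chipDivisor, Finset.sum_congr rfl fun e _ => edgeChip_eq hlen e (hmem e),
      Finset.sum_add_distrib, ← add_assoc, add_comm, sub_eq_add_neg]
    refine add_le_add le_rfl ?_
    have h1 : Γ.vertexDivisor (A + ∑ e, n e •
        (Finsupp.single (Γ.tgt e) 1 - Finsupp.single (Γ.src e) 1)) ≤
        Γ.vertexDivisor (-∑ v, Finsupp.single v 1) := by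
      refine vertexDivisor_mono fun v => (hA v).trans (le_of_eq ?_)
      classical
      simp [Finsupp.single_apply]
    rw [vertexDivisor_add, vertexDivisor_sum, ← zero_sub, vertexDivisor_sub, vertexDivisor_sum,
      vertexDivisor_zero, zero_sub] at h1
    simpa only [vertexDivisor_smul, vertexDivisor_sub, vertexDivisor_single] using h1

end Chips

end MetricGraph

end

/-! ### Positions and vertex orders on the complete graph -/

section

open Set Filter Topology

/-- The edges of the complete graph on `V`, oriented upwards. -/
abbrev CompleteEdge (V : Type*) [LinearOrder V] : Type _ :=
  {p : V × V // (SimpleGraph.completeGraph V).Adj p.1 p.2 ∧ p.1 < p.2}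

/-- The metric graph corresponding to the complete graph on `V`. -/
abbrev completeMetricGraph (V : Type*) [LinearOrder V] : MetricGraph V (CompleteEdge V) :=
  (SimpleGraph.completeGraph V).toMetricGraph

/-- `Y v w` is the position of a chip on the edge `vw`, measured from `v`. -/
def IsPosition {V : Type*} (Y : V → V → ℝ) : Prop := ∀ v w, v ≠ w → Y v w + Y w v = 1

theorem IsPosition.shift {V : Type*} {Y : V → V → ℝ} (hY : IsPosition Y) (h : V → ℝ) :
    IsPosition fun v w => Y v w + (h v - h w) := by
  intro v w hvw
  linarith [hY v w hvw]

theorem completeMetricGraph_len {V : Type*} [LinearOrder V] (e : CompleteEdge V) :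
    (completeMetricGraph V).len e = 1 := rfl

/-- The number of chips on the edge `wv` that arrive at `v` when the chips are pushed towards the
later endpoints in the order `π`, minus one. -/
noncomputable def orderTerm {V : Type*} (Y : V → V → ℝ) (π : V → ℕ) (w v : V) : ℤ :=
  if π w < π v then ⌈Y w v⌉ - 1 else ⌊Y w v⌋

/-- The coefficient at `v` when the chips are pushed towards the later endpoints in the order
`π`. -/
noncomputable def orderCoeff {V : Type*} [Fintype V] [DecidableEq V] (A : V → ℤ) (Y : V → V → ℝ)
    (π : V → ℕ) (v : V) : ℤ :=
  A v + ∑ w ∈ Finset.univ.erase v, orderTerm Y π w v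

/-- The later endpoint uses the ceiling and the earlier one the floor, and ⌊1 - x⌋ = 1 - ⌈x⌉
exchanges the two. Consequently the order does not affect the total of `orderCoeff`. -/
theorem IsPosition.orderTerm_antisymm {V : Type*} {Y : V → V → ℝ} (hY : IsPosition Y) {π : V → ℕ}
    (hπ : Function.Injective π) {v w : V} (hvw : v ≠ w) :
    orderTerm Y π w v = -orderTerm Y π v w := by
  have h1 : Y w v = 1 - Y v w := by linarith [hY v w hvw]
  have h2 : ⌊1 - Y v w⌋ = 1 - ⌈Y v w⌉ := by
    rw [sub_eq_add_neg, add_comm, Int.floor_add_one, Int.floor_neg]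
    ring
  have h3 : ⌈1 - Y v w⌉ = 1 - ⌊Y v w⌋ := by
    rw [sub_eq_add_neg, add_comm, Int.ceil_add_one, Int.ceil_neg]
    ring
  simp only [orderTerm]
  rw [h1]
  rcases lt_or_gt_of_ne (hπ.ne hvw) with h4 | h4
  · rw [if_neg h4.not_gt, if_pos h4, h2]
    ring
  · rw [if_neg h4.not_gt, if_pos h4, h3]
    ring

theorem IsPosition.sum_orderCoeff {V : Type*} [Fintype V] [DecidableEq V] (A : V → ℤ)
    {Y : V → V → ℝ} (hY : IsPosition Y) {π : V → ℕ} (hπ : Function.Injective π) :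
    ∑ v, orderCoeff A Y π v = ∑ v, A v := by
  have h1 : ∑ v, ∑ w ∈ Finset.univ.erase v, orderTerm Y π w v =
      ∑ v, ∑ w, if w ≠ v then orderTerm Y π w v else 0 := by
    refine Finset.sum_congr rfl fun v _ => ?_
    rw [← Finset.sum_filter]
    congr 1
    ext w
    simp
  have h2 : ∑ v, ∑ w, (if w ≠ v then orderTerm Y π w v else 0) =
      -∑ v, ∑ w, if w ≠ v then orderTerm Y π w v else 0 := by
    conv_lhs => rw [Finset.sum_comm]
    rw [← Finset.sum_neg_distrib]
    refine Finset.sum_congr rfl fun v _ => ?_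
    rw [← Finset.sum_neg_distrib]
    refine Finset.sum_congr rfl fun w _ => ?_
    by_cases h : v = w
    · simp [h]
    · rw [if_pos h, if_pos (Ne.symm h), hY.orderTerm_antisymm hπ (Ne.symm h)]
  simp only [orderCoeff, Finset.sum_add_distrib]
  rw [h1]
  linarith

section CompleteGraph

open MetricGraph

variable {V : Type*} [LinearOrder V] [Fintype (CompleteEdge V)]

/-- The divisor `chipDivisor` on a complete graph. -/
noncomputable def completeChip (A : V →₀ ℤ) (Y : V → V → ℝ) : (completeMetricGraph V).Point →₀ ℤ :=
  (completeMetricGraph V).chipDivisor A fun e => Y e.1.1 e.1.2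

theorem completeChip_sub (A B : V →₀ ℤ) (Y : V → V → ℝ) :
    completeChip (A - B) Y = completeChip A Y - (completeMetricGraph V).vertexDivisor B :=
  chipDivisor_sub _ _ _

theorem completeChip_shift (A : V →₀ ℤ) (Y : V → V → ℝ) (h : V → ℝ) :
    (completeMetricGraph V).LinEquiv (completeChip A Y)
      (completeChip A fun v w => Y v w + (h v - h w)) :=
  linEquiv_chipDivisor_shift completeMetricGraph_len A _ h

theorem exists_linEquiv_completeChip (D : (completeMetricGraph V).Point →₀ ℤ) :
    ∃ A Y, IsPosition Y ∧ (completeMetricGraph V).LinEquiv D (completeChip A Y) ∧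
      divisorDegree D = divisorDegree A + Fintype.card (CompleteEdge V) := by
  obtain ⟨A, y, h1, h2⟩ := exists_linEquiv_chipDivisor completeMetricGraph_len D
  refine ⟨A, fun v w => if h : v < w then y ⟨(v, w), h.ne, h⟩ else
    if h : w < v then 1 - y ⟨(w, v), h.ne, h⟩ else 0, ?_, ?_, by
      rw [h2, divisorDegree_chipDivisor]⟩
  · intro v w hvw
    rcases lt_or_gt_of_ne hvw with h | h
    · simp [h, h.not_gt]
    · simp [h, h.not_gt]
  · convert h1 using 1
    rw [completeChip]
    congr 1
    funext e
    rw [dif_pos e.2.2]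

theorem single_add_completeChip (A : V →₀ ℤ) {Y : V → V → ℝ} (hY : IsPosition Y)
    (e : CompleteEdge V) {t : ℝ} (ht : t ∈ Ioo 0 ((completeMetricGraph V).len e)) :
    ∃ Y', IsPosition Y' ∧ (completeMetricGraph V).LinEquiv
      (Finsupp.single (Point.interior e t ht) 1 + completeChip A Y)
      (completeChip (A + Finsupp.single e.1.1 1) Y') ∧
      Y' e.1.1 e.1.2 = Y e.1.1 e.1.2 + t ∧
      ∀ v w, (v, w) ≠ e.1 → (w, v) ≠ e.1 → Y' v w = Y v w := by
  classical
  have hne : e.1.1 ≠ e.1.2 := ne_of_lt e.2.2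
  have hsw : (e.1.2, e.1.1) ≠ e.1 := fun h => hne (congrArg Prod.snd h)
  refine ⟨fun v w => if (v, w) = e.1 then Y v w + t else if (w, v) = e.1 then Y v w - t else Y v w,
    ?_, ?_, by simp, fun v w h1 h2 => by simp [h1, h2]⟩
  · intro v w hvw
    have := hY v w hvw
    by_cases h1 : (v, w) = e.1
    · have h2 : (w, v) ≠ e.1 := by
        rw [← h1]
        intro h
        exact hvw (congrArg Prod.snd h)
      simp only [h1, h2, if_true, if_false]
      linarith
    · by_cases h2 : (w, v) = e.1
      · simp only [h1, h2, if_true, if_false]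
        linarith
      · simp only [h1, h2, if_false]
        linarith
  · refine cast ?_ (linEquiv_single_add_chipDivisor completeMetricGraph_len A
      (fun e => Y e.1.1 e.1.2) e ht)
    have h : Function.update (fun e : CompleteEdge V => Y e.1.1 e.1.2) e (Y e.1.1 e.1.2 + t) =
        fun e' => if (e'.1.1, e'.1.2) = e.1 then Y e'.1.1 e'.1.2 + t else
          if (e'.1.2, e'.1.1) = e.1 then Y e'.1.1 e'.1.2 - t else Y e'.1.1 e'.1.2 := by
      funext e'
      by_cases h : e' = e
      · subst h
        simp
      · have h1 : e'.1 ≠ e.1 := fun h' => h (Subtype.ext h')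
        have h2 : (e'.1.2, e'.1.1) ≠ e.1 := by
          intro h'
          have h3 := e'.2.2
          have h4 := e.2.2
          rw [← h'] at h4
          exact lt_asymm h3 h4
        rw [Function.update_of_ne h, if_neg h1, if_neg h2]
    rw [h]
    rfl

variable [Fintype V]

/-- Converts sums over oriented edges into sums over all other vertices, which do not see the
orientation. -/
theorem sum_completeEdge (M : V → V → ℤ) (v : V) :
    (∑ e : CompleteEdge V, (Finsupp.single e.1.2 (M e.1.1 e.1.2) +
      Finsupp.single e.1.1 (M e.1.2 e.1.1)) : V →₀ ℤ) v = ∑ w ∈ Finset.univ.erase v, M w v := by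
  have h1 : ∀ g : V × V → ℤ, ∑ e : CompleteEdge V, g e.1 =
      ∑ a, ∑ b, if a < b then g (a, b) else 0 := by
    intro g
    rw [← Finset.sum_subtype (Finset.univ.filter fun p : V × V => p.1 < p.2)
      (p := fun p : V × V => (SimpleGraph.completeGraph V).Adj p.1 p.2 ∧ p.1 < p.2)
      (fun p => by simpa using fun h => ne_of_lt h), Finset.sum_filter, Fintype.sum_prod_type]
  rw [Finsupp.finsetSum_apply]
  simp only [Finsupp.add_apply, Finsupp.single_apply]
  rw [h1 fun p => (if p.2 = v then M p.1 p.2 else 0) + if p.1 = v then M p.2 p.1 else 0]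
  have h2 : ∀ a b, (if a < b then (if b = v then M a b else 0) + (if a = v then M b a else 0)
      else 0) = (if b = v then (if a < v then M a v else 0) else 0) +
        (if a = v then (if v < b then M b v else 0) else 0) := by
    intro a b
    by_cases hb : b = v
    · by_cases ha : a = v
      · simp [ha, hb]
      · simp [ha, hb]
    · by_cases ha : a = v
      · simp [ha, hb]
      · simp [ha, hb]
  simp only [h2, Finset.sum_add_distrib]
  rw [Finset.sum_comm (f := fun a b => if a = v then (if v < b then M b v else 0) else 0)]
  simp only [Finset.sum_ite_eq', Finset.mem_univ, if_true]
  rw [← Finset.sum_add_distrib, ← Finset.add_sum_erase _ _ (Finset.mem_univ v)]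
  simp only [lt_irrefl, if_false, add_zero, zero_add]
  refine Finset.sum_congr rfl fun w hw => ?_
  rcases lt_or_gt_of_ne (Finset.ne_of_mem_erase hw) with h | h
  · simp [h, h.not_gt]
  · simp [h, h.not_gt]

theorem card_completeEdge : (Fintype.card (CompleteEdge V) : ℤ) * 2 =
    Fintype.card V * (Fintype.card V - 1) := by
  rcases isEmpty_or_nonempty V with hV | hV
  · have : IsEmpty (CompleteEdge V) := ⟨fun e => hV.elim e.1.1⟩
    simp
  have h1 : ∀ v, (∑ e : CompleteEdge V, (Finsupp.single e.1.2 1 +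
      Finsupp.single e.1.1 1) : V →₀ ℤ) v = Fintype.card V - 1 := by
    intro v
    rw [sum_completeEdge fun _ _ => 1]
    simp [Finset.card_erase_of_mem, Nat.cast_sub Fintype.card_pos]
  have h2 : divisorDegree (∑ e : CompleteEdge V, (Finsupp.single e.1.2 1 +
      Finsupp.single e.1.1 1) : V →₀ ℤ) = Fintype.card (CompleteEdge V) * 2 := by
    simp [divisorDegree_sum, divisorDegree_add, divisorDegree_single]
  rw [← h2, divisorDegree_eq_sum, Finset.sum_congr rfl fun v _ => h1 v, Finset.sum_const,
    Finset.card_univ, nsmul_eq_mul]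

theorem completeChip_linearSystem_eq_empty [Nonempty V] {A : V →₀ ℤ} {Y : V → V → ℝ}
    (hY : IsPosition Y) {π : V → ℕ} (hπ : Function.Injective π) (h : ∀ v, orderCoeff A Y π v ≤ -1) :
    linearSystem (completeMetricGraph V).LinEquiv (completeChip A Y) = ∅ := by
  refine linearSystem_chipDivisor_eq_empty completeMetricGraph_len π
    (fun e => hπ.ne (ne_of_lt e.2.2)) A _ (fun e => orderTerm Y π e.1.1 e.1.2) (fun e => rfl) fun v => ?_
  refine le_trans (le_of_eq ?_) (h v)
  rw [Finsupp.add_apply, orderCoeff]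
  congr 1
  rw [← sum_completeEdge (orderTerm Y π) v]
  congr 1
  refine Finset.sum_congr rfl fun e _ => ?_
  rw [hY.orderTerm_antisymm hπ (ne_of_lt e.2.2), smul_sub, sub_eq_add_neg, ← smul_neg, ← Finsupp.single_neg,
    Finsupp.smul_single, Finsupp.smul_single]
  simp [SimpleGraph.toMetricGraph]

theorem completeChip_nonneg {A : V →₀ ℤ} {Y : V → V → ℝ} (hY : IsPosition Y)
    (h : ∀ v, 0 ≤ A v + ∑ w ∈ Finset.univ.erase v, ⌊Y w v⌋) : 0 ≤ completeChip A Y := by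
  have h1 : (completeMetricGraph V).vertexDivisor (A + ∑ e : CompleteEdge V,
      (Finsupp.single e.1.2 ⌊Y e.1.1 e.1.2⌋ + Finsupp.single e.1.1 ⌊Y e.1.2 e.1.1⌋)) ≤
      completeChip A Y := by
    rw [vertexDivisor_add, vertexDivisor_sum, completeChip, chipDivisor]
    refine add_le_add le_rfl (Finset.sum_le_sum fun e _ => ?_)
    have h2 : Y e.1.2 e.1.1 = 1 - Y e.1.1 e.1.2 := by linarith [hY _ _ (ne_of_lt e.2.2)]
    rw [h2]
    exact edgeChip_ge (Γ := completeMetricGraph V) e _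
  refine le_trans ?_ h1
  rw [← vertexDivisor_zero]
  refine vertexDivisor_mono fun v => ?_
  rw [Finsupp.add_apply, sum_completeEdge fun w v => ⌊Y w v⌋]
  exact h v

end CompleteGraph

end

/-! ### An inequality between monotone lattice paths and staircases -/

section Staircase

open Finset

theorem sum_le_of_le_card_filter (B : Finset ℕ) (c : ℕ → ℤ)
    (hc : ∀ i ∈ B, c i ≤ (B.filter (· ≤ i)).card) :
    2 * ∑ i ∈ B, c i ≤ B.card * (B.card + 1) := by
  induction B using Finset.induction_on_max with
  | empty => simp
  | insert a s ha ih =>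
    have ha' : a ∉ s := fun h => lt_irrefl _ (ha a h)
    rw [sum_insert ha', card_insert_of_notMem ha']
    have h1 := hc a (mem_insert_self a s)
    have h2 : ((insert a s).filter (· ≤ a)).card ≤ s.card + 1 :=
      (card_filter_le _ _).trans (card_insert_le _ _)
    have h3 := ih fun i hi => by
      refine (hc i (mem_insert_of_mem hi)).trans (le_of_eq ?_)
      rw [filter_insert, if_neg (not_le.mpr (ha i hi))]
    push_cast
    have h4 : (((insert a s).filter (· ≤ a)).card : ℤ) ≤ s.card + 1 := by exact_mod_cast h2
    nlinarith

theorem two_mul_sum_range (n : ℕ) : 2 * ∑ i ∈ range n, (i : ℤ) = n * (n - 1) := by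
  induction n with
  | zero => simp
  | succ n ih =>
    rw [sum_range_succ, mul_add, ih]
    push_cast
    ring

theorem two_mul_sum_range_min (n k : ℕ) (hk : k ≤ n) :
    2 * ∑ i ∈ range n, min (i : ℤ) k = 2 * k * n - k * (k + 1) := by
  induction n, hk using Nat.le_induction with
  | base =>
    rw [sum_congr rfl fun i hi => min_eq_left (by exact_mod_cast (mem_range.mp hi).le),
      two_mul_sum_range]
    ring
  | succ n hn ih =>
    rw [sum_range_succ, mul_add, ih, min_eq_right (by exact_mod_cast hn)]
    push_cast
    ring

/-- Split the indices into `B`, where the path `v` lies below the diagonal, and its complement `G`.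
If the conclusion failed, `B` would be large and `G` would have at most `k` elements, which makes
the excess over the diagonal at most `k * (k + 1) / 2`, against `hP`. -/
theorem sum_min_ge_of_lt_sum {m k : ℕ} (hk : k ≤ m) (v : ℕ → ℤ) {q : ℤ} (hq : 0 ≤ q)
    (hmono : ∀ i j, i ≤ j → j < m → v i ≤ v j) (hlow : ∀ i < m, q ≤ v i)
    (hup : ∀ i < m, v i ≤ q + i)
    (hP : k * (k + 1) < 2 * ∑ i ∈ range m, max 0 (v i + 1 - i)) :
    ∑ i ∈ range m, min (i : ℤ) k ≤ ∑ i ∈ range m, min (i : ℤ) (v i) := by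
  by_contra hL
  push Not at hL
  set B := (range m).filter fun i => v i < i with hB
  set G := (range m).filter fun i => ¬v i < i with hG
  have hcard : B.card + G.card = m := by
    rw [hB, hG, card_filter_add_card_filter_not, card_range]
  have hBsum : ∑ i ∈ range m, min (i : ℤ) (v i) =
      ∑ i ∈ range m, (i : ℤ) - ∑ i ∈ B, ((i : ℤ) - v i) := by
    rw [hB, sum_filter, ← sum_sub_distrib]
    refine sum_congr rfl fun i _ => ?_
    split_ifs with h
    · rw [min_eq_right h.le]; ring
    · rw [min_eq_left (not_lt.mp h)]; ring
  have hBle : 2 * ∑ i ∈ B, ((i : ℤ) - v i) ≤ B.card * (B.card + 1) := by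
    refine sum_le_of_le_card_filter B (fun i => (i : ℤ) - v i) fun i hi => ?_
    obtain ⟨him, hvi⟩ := mem_filter.mp hi
    rw [mem_range] at him
    have hv0 : 0 ≤ v i := hq.trans (hlow i him)
    -- By monotonicity all `j` with `v i < j ≤ i` lie below the diagonal too, so the deficit at `i`
    -- is at most the rank of `i` in `B`.
    have hsub : Ioc (v i).toNat i ⊆ B.filter (· ≤ i) := by
      intro j hj
      rw [mem_Ioc] at hj
      refine mem_filter.mpr ⟨mem_filter.mpr ⟨mem_range.mpr (hj.2.trans_lt him), ?_⟩, hj.2⟩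
      have := hmono j i hj.2 him
      omega
    have := card_le_card hsub
    rw [Nat.card_Ioc] at this
    omega
  have h1 := two_mul_sum_range m
  have h2 := two_mul_sum_range_min m k hk
  -- Capping at `k` costs 1 + ... + (m - 1 - k), whereas capping at `v` costs at most 1 + ... + |B|.
  -- So failure forces |B| > m - 1 - k.
  have hGk : G.card ≤ k := by
    by_contra hc
    push Not at hc
    have hcz : (B.card : ℤ) + G.card = m := by exact_mod_cast hcard
    have hcz' : (k : ℤ) + 1 ≤ G.card := by exact_mod_cast hc
    have hb : (B.card : ℤ) ≤ m - 1 - k := by linarith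
    have hb0 : (0 : ℤ) ≤ B.card := by positivity
    nlinarith
  have hBne : B.Nonempty := by
    rw [nonempty_iff_ne_empty]
    intro hE
    rw [hE, sum_empty, sub_zero] at hBsum
    rw [hBsum] at hL
    exact absurd hL (not_lt.mpr (sum_le_sum fun i _ => min_le_left _ _))
  set b := B.min' hBne with hb
  obtain ⟨hbm, hvb⟩ := mem_filter.mp (B.min'_mem hBne)
  rw [mem_range, ← hb] at hbm
  rw [← hb] at hvb
  have hqb : q + 1 ≤ b := by linarith [hlow b hbm]
  have hsplit : ∑ i ∈ range m, max 0 (v i + 1 - i) = ∑ i ∈ G, max 0 (v i + 1 - i) := by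
    rw [hG, sum_filter]
    refine sum_congr rfl fun i _ => ?_
    split_ifs with h
    · rw [max_eq_left]; omega
    · rfl
  have hsubG : range b ⊆ G := by
    intro i hi
    rw [mem_range] at hi
    refine mem_filter.mpr ⟨mem_range.mpr (hi.trans hbm), fun h => ?_⟩
    have := B.min'_le i (mem_filter.mpr ⟨mem_range.mpr (hi.trans hbm), h⟩)
    omega
  rw [hsplit, ← sum_sdiff hsubG] at hP
  -- Beyond the first index `b` below the diagonal the excess is at most `q + 1`, and `q ≤ v b < b`.
  have hS1 : ∑ i ∈ G \ range b, max 0 (v i + 1 - i) ≤ (G \ range b).card * (b : ℤ) := by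
    rw [← nsmul_eq_mul]
    refine sum_le_card_nsmul _ _ _ fun i hi => ?_
    have him := mem_range.mp (mem_filter.mp (mem_sdiff.mp hi).1).1
    have := hup i him
    refine max_le (by positivity) (by linarith)
  have hS2 : ∑ i ∈ range b, max 0 (v i + 1 - i) ≤ ∑ i ∈ range b, ((b : ℤ) - i) := by
    refine sum_le_sum fun i hi => ?_
    rw [mem_range] at hi
    have := hmono i b hi.le hbm
    refine max_le (by omega) (by linarith)
  rw [sum_sub_distrib, sum_const, card_range, nsmul_eq_mul] at hS2
  have h3 := two_mul_sum_range b
  have hc2 : (G \ range b).card + b = G.card := by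
    rw [card_sdiff_of_subset hsubG, card_range]
    have := card_le_card hsubG
    rw [card_range] at this
    omega
  have hc2' : ((G \ range b).card : ℤ) + b = G.card := by exact_mod_cast hc2
  have hGk' : (G.card : ℤ) ≤ k := by exact_mod_cast hGk
  have hg0 : (0 : ℤ) ≤ (G \ range b).card := by positivity
  have hb0 : (0 : ℤ) ≤ b := by positivity
  have hkk : (G.card : ℤ) * (G.card + 1) ≤ k * (k + 1) := by
    have : (0 : ℤ) ≤ G.card := by positivity
    nlinarith
  rw [← hc2'] at hkk
  nlinarith

/-- Each term is its excess over `i` plus its minimum with `i`. The excesses add up to `P`; the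
minima only decrease when the `ε i` are dropped, which leaves the previous lemma. -/
theorem sum_ge_of_lt_sum {m k : ℕ} (hk : k ≤ m) (z ε : ℕ → ℤ) {q : ℤ} (hq : 0 ≤ q)
    (hmono : ∀ i j, i ≤ j → j < m → z i ≤ z j) (hlow : ∀ i < m, 0 ≤ z i) (hup : ∀ i < m, z i ≤ i)
    (hε : ∀ i < m, 0 ≤ ε i ∧ ε i ≤ 1) {P : ℤ}
    (hPeq : P = ∑ i ∈ range m, max 0 (q + ε i + z i - i)) (hP : k * (k + 1) < 2 * P) :
    2 * P + 2 * k * m - k * (k + 1) ≤ 2 * ∑ i ∈ range m, (q + ε i + z i) := by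
  have h1 := sum_min_ge_of_lt_sum hk (fun i => q + z i) hq
    (fun i j hij hj => by linarith [hmono i j hij hj]) (fun i hi => by linarith [hlow i hi])
    (fun i hi => by linarith [hup i hi]) (by
      refine hP.trans_le (mul_le_mul_of_nonneg_left ?_ (by norm_num))
      rw [hPeq]
      refine sum_le_sum fun i hi => max_le_max le_rfl ?_
      linarith [(hε i (mem_range.mp hi)).2])
  have h2 := two_mul_sum_range_min m k hk
  have h3 : ∑ i ∈ range m, (q + ε i + z i) =
      P + ∑ i ∈ range m, min (i : ℤ) (q + ε i + z i) := by
    rw [hPeq, ← sum_add_distrib]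
    refine sum_congr rfl fun i _ => ?_
    rcases le_total (i : ℤ) (q + ε i + z i) with h | h
    · rw [max_eq_right (by linarith), min_eq_left h]; ring
    · rw [max_eq_left (by linarith), min_eq_right h]; ring
  have h4 : ∑ i ∈ range m, min (i : ℤ) (q + z i) ≤
      ∑ i ∈ range m, min (i : ℤ) (q + ε i + z i) :=
    sum_le_sum fun i hi => min_le_min le_rfl (by linarith [(hε i (mem_range.mp hi)).1])
  linarith

end Staircase

/-! ### Reduced divisors and burning orders with real firing amounts -/

section

open Set Filter Topology

/-- The coefficient at `u` when the chips on the edges to the vertices of `B` are pushed away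
from `B`. -/
noncomputable def burnCoeff {V : Type*} [Fintype V] [DecidableEq V] (A : V → ℤ) (Y : V → V → ℝ)
    (B : Finset V) (u : V) : ℤ :=
  A u + ∑ w ∈ Finset.univ.erase u, if w ∈ B then ⌈Y w u⌉ - 1 else ⌊Y w u⌋

section Reduced

variable {V : Type*} [Fintype V] [DecidableEq V]

theorem floor_le_ceil_sub_one_add_one (x : ℝ) : ⌊x⌋ ≤ ⌈x⌉ - 1 + 1 := by
  simpa using Int.floor_le_ceil x

/-- Each newly burnt vertex replaces a floor by a ceiling minus one, a loss of at most 1. -/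
theorem burnCoeff_le {A : V → ℤ} {Y : V → V → ℝ} {B B' : Finset V} (h : B ⊆ B') (u : V) :
    burnCoeff A Y B u ≤ burnCoeff A Y B' u + (B'.card - B.card) := by
  have h1 : ∀ w, (if w ∈ B then ⌈Y w u⌉ - 1 else ⌊Y w u⌋) ≤
      (if w ∈ B' then ⌈Y w u⌉ - 1 else ⌊Y w u⌋) + if w ∈ B' \ B then 1 else 0 := by
    intro w
    have := floor_le_ceil_sub_one_add_one (Y w u)
    by_cases hw : w ∈ B
    · simp [hw, h hw]
    · by_cases hw' : w ∈ B'
      · simpa [hw, hw'] using this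
      · simp [hw, hw']
  have h2 : ∑ w ∈ Finset.univ.erase u, (if w ∈ B' \ B then (1 : ℤ) else 0) ≤
      B'.card - B.card := by
    refine (Finset.sum_le_sum_of_subset_of_nonneg (Finset.erase_subset _ _)
      fun w _ _ => by split_ifs <;> norm_num).trans ?_
    rw [Finset.sum_ite_mem, Finset.univ_inter, Finset.sum_const, nsmul_eq_mul, mul_one,
      Finset.card_sdiff_of_subset h, Nat.cast_sub (Finset.card_le_card h)]
  have h3 := Finset.sum_le_sum fun w (_ : w ∈ Finset.univ.erase u) => h1 w
  rw [Finset.sum_add_distrib] at h3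
  unfold burnCoeff
  linarith

/-- The floor is upper semicontinuous, hence superlevel sets of sums of floors are closed. -/
theorem isClosed_setOf_floor_sum_nonneg (a : ℤ) (Y : V → V → ℝ) (v : V) :
    IsClosed {h : V → ℝ | 0 ≤ a + ∑ w ∈ Finset.univ.erase v, ⌊Y w v + (h w - h v)⌋} := by
  rw [← isOpen_compl_iff, isOpen_iff_mem_nhds]
  intro h₀ hh₀
  have h1 : ∀ᶠ h in 𝓝 h₀, ∀ w ∈ Finset.univ.erase v,
      ⌊Y w v + (h w - h v)⌋ ≤ ⌊Y w v + (h₀ w - h₀ v)⌋ := by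
    rw [eventually_all_finset]
    intro w _
    have hc : Continuous fun h : V → ℝ => Y w v + (h w - h v) := by fun_prop
    filter_upwards [hc.continuousAt.eventually_lt_const (Int.lt_floor_add_one _)] with h hh
    exact Int.lt_add_one_iff.mp (Int.floor_lt.mpr (by exact_mod_cast hh))
  filter_upwards [h1] with h hh
  simp only [mem_compl_iff, mem_ofPred_eq, not_le] at hh₀ ⊢
  exact lt_of_le_of_lt (by linarith [Finset.sum_le_sum hh]) hh₀

/-- Among potentials vanishing at `o` with nonnegative coefficients elsewhere, one of maximal sum
exists by compactness. If a fire starting from `B` burnt nothing more, the potential could be raised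
slightly outside `B`. -/
theorem exists_reduced_shift (A : V → ℤ) (Y : V → V → ℝ) (o : V) :
    ∃ h : V → ℝ,
      (∀ v ≠ o, 0 ≤ A v + ∑ w ∈ Finset.univ.erase v, ⌊Y w v + (h w - h v)⌋) ∧
      ∀ B : Finset V, o ∈ B → B ≠ Finset.univ →
        ∃ u ∉ B, burnCoeff A (fun v w => Y v w + (h v - h w)) B u ≤ -1 := by
  let H : Set (V → ℝ) := {h | h o = 0 ∧
    ∀ v ≠ o, 0 ≤ A v + ∑ w ∈ Finset.univ.erase v, ⌊Y w v + (h w - h v)⌋}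
  have hHclosed : IsClosed H := by
    have h1 : H = {h | h o = 0} ∩ ⋂ v, ⋂ (_ : v ≠ o),
        {h | 0 ≤ A v + ∑ w ∈ Finset.univ.erase v, ⌊Y w v + (h w - h v)⌋} := by
      ext h
      simp [H]
    rw [h1]
    exact (isClosed_eq (continuous_apply o) continuous_const).inter
      (isClosed_iInter fun v => isClosed_iInter fun _ => isClosed_setOf_floor_sum_nonneg _ _ _)
  let C : ℝ := ∑ u, (|(A u : ℝ)| + ∑ w, |Y w u|)
  have hCu : ∀ u, |(A u : ℝ)| + ∑ w, |Y w u| ≤ C := fun u =>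
    Finset.single_le_sum (f := fun u => |(A u : ℝ)| + ∑ w, |Y w u|)
      (fun u _ => by positivity) (Finset.mem_univ u)
  have hC0 : 0 ≤ C := by positivity
  -- At a vertex `u ≠ o` where `h` is largest, the edge to `o` contributes at most `Y o u - h u` and
  -- any other at most `Y w u`. Nonnegativity at `u` thus bounds `h u` by `C`.
  have hHC : ∀ h ∈ H, ∀ v, h v ≤ C := by
    intro h hh v
    have : Nonempty V := ⟨o⟩
    obtain ⟨u, hu⟩ := Finite.exists_max h
    refine (hu v).trans ?_
    by_cases huo : u = o
    · rw [huo, hh.1]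
      exact hC0
    have h1 := hh.2 u huo
    have h2 : ∀ w ∈ Finset.univ.erase u, ((⌊Y w u + (h w - h u)⌋ : ℤ) : ℝ) ≤
        |Y w u| + if w = o then -h u else 0 := by
      intro w _
      refine (Int.floor_le _).trans (add_le_add (le_abs_self _) ?_)
      split_ifs with hw
      · rw [hw, hh.1, zero_sub]
      · linarith [hu w]
    have h3 := Finset.sum_le_sum h2
    rw [Finset.sum_add_distrib, Finset.sum_ite_eq', if_pos (by simpa using Ne.symm huo)] at h3
    have h4 : ∑ w ∈ Finset.univ.erase u, |Y w u| ≤ ∑ w, |Y w u| :=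
      Finset.sum_le_sum_of_subset_of_nonneg (Finset.erase_subset _ _) fun w _ _ => abs_nonneg _
    have h5 : (0 : ℝ) ≤ A u + ∑ w ∈ Finset.univ.erase u, ((⌊Y w u + (h w - h u)⌋ : ℤ) : ℝ) := by
      exact_mod_cast h1
    linarith [hCu u, le_abs_self (A u : ℝ)]
  obtain ⟨h₀, hh₀⟩ : H.Nonempty := by
    -- Lowering all vertices but `o` by the integer `M` gives each of them `M` chips through its
    -- edge to `o`.
    let M : ℤ := ∑ v, |A v + ∑ w ∈ Finset.univ.erase v, ⌊Y w v⌋|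
    refine ⟨fun v => if v = o then 0 else -M, by simp, fun v hv => ?_⟩
    have h1 : ∀ w ∈ Finset.univ.erase v, ⌊Y w v + ((if w = o then (0 : ℝ) else -M) -
        (if v = o then (0 : ℝ) else -M))⌋ = ⌊Y w v⌋ + if w = o then M else 0 := by
      intro w _
      rw [if_neg hv]
      split_ifs
      · rw [zero_sub, neg_neg, Int.floor_add_intCast]
      · simp
    beta_reduce
    rw [Finset.sum_congr rfl h1, Finset.sum_add_distrib, Finset.sum_ite_eq',
      if_pos (by simpa using Ne.symm hv)]
    have h2 : |A v + ∑ w ∈ Finset.univ.erase v, ⌊Y w v⌋| ≤ M :=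
      Finset.single_le_sum (f := fun v => |A v + ∑ w ∈ Finset.univ.erase v, ⌊Y w v⌋|)
        (fun u _ => abs_nonneg _) (Finset.mem_univ v)
    linarith [neg_abs_le (A v + ∑ w ∈ Finset.univ.erase v, ⌊Y w v⌋)]
  -- Potentials of smaller sum are irrelevant to the maximum; a lower bound on the sum and the upper
  -- bound `C` bound every value from below.
  let K : Set (V → ℝ) := {h | h ∈ H ∧ ∑ v, h₀ v ≤ ∑ v, h v}
  have hKc : IsCompact K := by
    refine (isCompact_Icc (a := fun _ : V => ∑ v, h₀ v - Fintype.card V * C)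
      (b := fun _ => C)).of_isClosed_subset ?_ ?_
    · exact hHclosed.inter (isClosed_le continuous_const
        (continuous_finsetSum _ fun v _ => continuous_apply v))
    · rintro h ⟨hh, hs⟩
      refine ⟨fun v => ?_, hHC h hh⟩
      have h1 : ∑ w, h w ≤ h v + Fintype.card V * C := by
        rw [← Finset.add_sum_erase _ _ (Finset.mem_univ v)]
        have h2 : ∑ w ∈ Finset.univ.erase v, h w ≤ ∑ w : V, C :=
          (Finset.sum_le_sum fun w _ => hHC h hh w).trans
            (Finset.sum_le_sum_of_subset_of_nonneg (Finset.erase_subset _ _) fun _ _ _ => hC0)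
        rw [Finset.sum_const, nsmul_eq_mul, Finset.card_univ] at h2
        linarith
      linarith
  obtain ⟨h, ⟨hH, hs⟩, hmax⟩ := hKc.exists_isMaxOn ⟨h₀, hh₀, le_rfl⟩
    (f := fun h : V → ℝ => ∑ v, h v) (by fun_prop)
  refine ⟨h, hH.2, fun B hoB hB => ?_⟩
  by_contra! hcon
  set Y' : V → V → ℝ := fun v w => Y v w + (h v - h w) with hY'
  -- Lowering a position x by at most x - (⌈x⌉ - 1) keeps its floor at least ⌈x⌉ - 1, the value used
  -- by `burnCoeff`.
  obtain ⟨δ, hδ0, hδ⟩ : ∃ δ > 0, ∀ w u, δ ≤ Y' w u - (⌈Y' w u⌉ - 1) := by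
    have : Nonempty (V × V) := ⟨(o, o)⟩
    obtain ⟨p, hp⟩ := Finite.exists_min fun p : V × V => Y' p.1 p.2 - (⌈Y' p.1 p.2⌉ - 1)
    exact ⟨_, by linarith [Int.ceil_lt_add_one (Y' p.1 p.2)], fun w u => hp (w, u)⟩
  let h' : V → ℝ := fun v => h v + if v ∈ B then 0 else δ
  have hh'H : h' ∈ H := by
    refine ⟨by simp [h', hoB, hH.1], fun v hv => ?_⟩
    by_cases hvB : v ∈ B
    · refine (hH.2 v hv).trans (add_le_add le_rfl (Finset.sum_le_sum fun w _ => ?_))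
      refine Int.floor_le_floor ?_
      simp only [h', hvB, if_true]
      split_ifs <;> linarith
    · have h1 : 0 ≤ burnCoeff A Y' B v := by
        have := hcon v hvB
        omega
      refine h1.trans (add_le_add le_rfl (Finset.sum_le_sum fun w _ => ?_))
      have h2 := hδ w v
      have h3 : Y' w v = Y w v + (h w - h v) := rfl
      simp only [h', hvB, if_false]
      split_ifs with hw
      · refine Int.le_floor.mpr ?_
        push_cast
        linarith
      · refine Int.floor_le_floor ?_
        linarith
  have hsum : ∑ v, h v < ∑ v, h' v := by
    obtain ⟨u, hu⟩ : ∃ u, u ∉ B := by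
      by_contra! hc
      exact hB (Finset.eq_univ_of_forall hc)
    refine Finset.sum_lt_sum (fun v _ => ?_) ⟨u, Finset.mem_univ u, ?_⟩
    · simp only [h']
      split_ifs <;> linarith
    · simp only [h', hu, if_false]
      linarith
  exact absurd (hmax ⟨hh'H, hs.trans hsum.le⟩) (not_le.mpr hsum)

/-- Always burn next a vertex of smallest `φ`. Any burnable vertex would make a burning order; the
greedy choice is what later makes the path monotone. -/
theorem exists_greedy_order (φ : Finset V → V → ℤ) (o : V) {m : ℕ} (hm : Fintype.card V = m + 1) :
    ∃ σ : Fin (m + 1) ≃ V, σ 0 = o ∧ ∀ i, i ≠ 0 → ∀ u ∉ (Finset.Iio i).image σ,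
      φ ((Finset.Iio i).image σ) (σ i) ≤ φ ((Finset.Iio i).image σ) u := by
  have hex : ∀ B : Finset V, ∃ u, B ≠ Finset.univ → u ∉ B ∧ ∀ w ∉ B, φ B u ≤ φ B w := by
    intro B
    by_cases hB : B = Finset.univ
    · exact ⟨o, fun h => absurd hB h⟩
    · have hne : (Bᶜ).Nonempty := by
        rwa [Finset.nonempty_iff_ne_empty, Ne, Finset.compl_eq_empty_iff]
      obtain ⟨u, hu, hmin⟩ := Finset.exists_min_image Bᶜ (φ B) hne
      exact ⟨u, fun _ => ⟨Finset.mem_compl.mp hu, fun w hw => hmin w (Finset.mem_compl.mpr hw)⟩⟩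
  choose next hnext using hex
  let Bs : ℕ → Finset V := fun n => Nat.rec {o} (fun _ B => insert (next B) B) n
  let s : ℕ → V := fun n => Nat.casesOn n o fun n => next (Bs n)
  have hBs : ∀ n, Bs n = (Finset.range (n + 1)).image s := by
    intro n
    induction n with
    | zero => simp [Bs, s]
    | succ n ih =>
      rw [Finset.range_add_one, Finset.image_insert, ← ih]
  have hcard : ∀ n ≤ m, (Bs n).card = n + 1 := by
    intro n
    induction n with
    | zero => simp [Bs]
    | succ n ih =>
      intro hn
      have h1 := ih (by omega)
      have h2 : Bs n ≠ Finset.univ := by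
        intro h
        rw [h, Finset.card_univ, hm] at h1
        omega
      change (insert (next (Bs n)) (Bs n)).card = _
      rw [Finset.card_insert_of_notMem (hnext _ h2).1, h1]
  have hinj : Set.InjOn s (Finset.range (m + 1)) := by
    rw [← Finset.card_image_iff, ← hBs, hcard m le_rfl, Finset.card_range]
  have hbij : Function.Bijective fun i : Fin (m + 1) => s i := by
    rw [Fintype.bijective_iff_injective_and_card]
    refine ⟨fun i j hij => Fin.ext (hinj ?_ ?_ hij), by simp [hm]⟩
    · simpa using i.is_le
    · simpa using j.is_le
  refine ⟨Equiv.ofBijective _ hbij, rfl, fun i hi u hu => ?_⟩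
  obtain ⟨n, hn⟩ : ∃ n, (i : ℕ) = n + 1 := Nat.exists_eq_succ_of_ne_zero (by
    intro h
    exact hi (Fin.ext h))
  have hB : (Finset.Iio i).image (Equiv.ofBijective (fun i : Fin (m + 1) => s i) hbij) = Bs n := by
    rw [hBs]
    ext v
    simp only [Finset.mem_image, Finset.mem_Iio, Finset.mem_range, Equiv.ofBijective_apply]
    constructor
    · rintro ⟨j, hj, rfl⟩
      exact ⟨j, by rw [Fin.lt_def, hn] at hj; exact hj, rfl⟩
    · rintro ⟨j, hj, rfl⟩
      refine ⟨⟨j, ?_⟩, ?_, rfl⟩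
      · have := i.isLt
        omega
      · exact Fin.lt_def.mpr (hj.trans_eq hn.symm)
  rw [hB] at hu ⊢
  have h1 : Bs n ≠ Finset.univ := fun h => hu (h ▸ Finset.mem_univ u)
  have h2 : Equiv.ofBijective (fun i : Fin (m + 1) => s i) hbij i = next (Bs n) := by
    simp [hn, s]
  rw [h2]
  exact (hnext _ h1).2 u hu

theorem orderCoeff_eq_burnCoeff (A : V → ℤ) (Y : V → V → ℝ) {m : ℕ} (σ : Fin (m + 1) ≃ V)
    (i : Fin (m + 1)) : orderCoeff A Y (fun v => (σ.symm v : ℕ)) (σ i) =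
      burnCoeff A Y ((Finset.Iio i).image σ) (σ i) := by
  unfold orderCoeff burnCoeff orderTerm
  congr 1
  refine Finset.sum_congr rfl fun w _ => ?_
  have : w ∈ (Finset.Iio i).image σ ↔ (σ.symm w : ℕ) < (σ.symm (σ i) : ℕ) := by
    rw [σ.symm_apply_apply, Fin.val_fin_lt]
    constructor
    · intro h
      obtain ⟨j, hj, rfl⟩ := Finset.mem_image.mp h
      simpa using hj
    · intro h
      exact Finset.mem_image.mpr ⟨_, Finset.mem_Iio.mpr h, σ.apply_symm_apply w⟩
  simp only [this]

/-- Existence of reduced divisors in every class, together with an order in which a fire lit at the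
first vertex burns the vertices. -/
theorem exists_reduced_order (A : V → ℤ) (Y : V → V → ℝ) {m : ℕ} (hm : Fintype.card V = m + 1) :
    ∃ (h : V → ℝ) (σ : Fin (m + 1) ≃ V), ∀ Y', (Y' = fun v w => Y v w + (h v - h w)) →
      (∀ v ≠ σ 0, 0 ≤ A v + ∑ w ∈ Finset.univ.erase v, ⌊Y' w v⌋) ∧
      (∀ i, i ≠ 0 → orderCoeff A Y' (fun v => (σ.symm v : ℕ)) (σ i) ≤ -1 ∧
        -(i : ℤ) ≤ orderCoeff A Y' (fun v => (σ.symm v : ℕ)) (σ i)) ∧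
      ∀ i j, i ≠ 0 → i ≤ j → orderCoeff A Y' (fun v => (σ.symm v : ℕ)) (σ i) + (i : ℤ) ≤
        orderCoeff A Y' (fun v => (σ.symm v : ℕ)) (σ j) + (j : ℤ) := by
  obtain ⟨o⟩ : Nonempty V := Fintype.card_pos_iff.mp (by omega)
  obtain ⟨h, h1, h2⟩ := exists_reduced_shift A Y o
  obtain ⟨σ, hσ0, hσ⟩ := exists_greedy_order
    (burnCoeff A fun v w => Y v w + (h v - h w)) o hm
  refine ⟨h, σ, ?_⟩
  rintro Y' rfl
  have hcard : ∀ i : Fin (m + 1), ((Finset.Iio i).image σ).card = i := by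
    intro i
    rw [Finset.card_image_of_injective _ σ.injective, Fin.card_Iio]
  have hnot : ∀ i j : Fin (m + 1), i ≤ j → σ j ∉ (Finset.Iio i).image σ := by
    intro i j hij hmem
    obtain ⟨k, hk, hkj⟩ := Finset.mem_image.mp hmem
    rw [σ.injective hkj, Finset.mem_Iio] at hk
    exact absurd hij (not_le.mpr hk)
  refine ⟨by rw [hσ0]; exact h1, fun i hi => ⟨?_, ?_⟩, fun i j hi hij => ?_⟩
  · obtain ⟨u, hu, hu1⟩ := h2 ((Finset.Iio i).image σ)
      (Finset.mem_image.mpr ⟨0, Finset.mem_Iio.mpr (Fin.pos_of_ne_zero hi), hσ0⟩)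
      fun hc => hnot i i le_rfl (hc ▸ Finset.mem_univ _)
    rw [orderCoeff_eq_burnCoeff]
    exact (hσ i hi u hu).trans hu1
  · have h3 := burnCoeff_le (A := A) (Y := fun v w => Y v w + (h v - h w))
      (Finset.empty_subset ((Finset.Iio i).image σ)) (σ i)
    have h4 := h1 (σ i) (fun hc => hi (σ.injective (hc.trans hσ0.symm)))
    rw [hcard] at h3
    rw [orderCoeff_eq_burnCoeff]
    simp only [Finset.card_empty, Nat.cast_zero, sub_zero] at h3
    have h5 : burnCoeff A (fun v w => Y v w + (h v - h w)) ∅ (σ i) =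
        A (σ i) + ∑ w ∈ Finset.univ.erase (σ i), ⌊Y w (σ i) + (h w - h (σ i))⌋ := by
      simp [burnCoeff]
    linarith
  · rw [orderCoeff_eq_burnCoeff, orderCoeff_eq_burnCoeff]
    -- `σ j` was still available when `σ i` was chosen, and its coefficient drops by at most `j - i`
    -- until its own turn.
    have h3 := hσ i hi (σ j) (hnot i j hij)
    have h4 := burnCoeff_le (A := A) (Y := fun v w => Y v w + (h v - h w))
      (Finset.image_subset_image (f := σ) (Finset.Iio_subset_Iio hij)) (σ j)
    rw [hcard, hcard] at h4
    linarith

end Reduced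

end

/-! ### Firing the base vertex by a real amount -/

section

open Set Filter Topology

/-- Breaking ties by index allows any prescribed number of values to be selected, even when several
values coincide. -/
theorem exists_card_filter_lex_le {m : ℕ} (β : Fin m → ℝ) {s : ℕ} (hs : s < m) :
    ∃ j, (Finset.univ.filter fun i => β i < β j ∨ (β i = β j ∧ i ≤ j)).card = s + 1 := by
  let f : Fin m → ℝ ×ₗ Fin m := fun i => toLex (β i, i)
  have hf : Function.Injective f := fun i j h => (Prod.ext_iff.mp (toLex.injective h)).2
  have hmono : StrictMono (f ∘ Tuple.sort f) :=
    (Tuple.monotone_sort f).strictMono_of_injective (hf.comp (Tuple.sort f).injective)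
  refine ⟨Tuple.sort f ⟨s, hs⟩, ?_⟩
  have h1 : (Finset.univ.filter fun i => β i < β (Tuple.sort f ⟨s, hs⟩) ∨
      (β i = β (Tuple.sort f ⟨s, hs⟩) ∧ i ≤ Tuple.sort f ⟨s, hs⟩)) =
      (Finset.Iic (⟨s, hs⟩ : Fin m)).image (Tuple.sort f) := by
    ext i
    have h2 : (β i < β (Tuple.sort f ⟨s, hs⟩) ∨ (β i = β (Tuple.sort f ⟨s, hs⟩) ∧
        i ≤ Tuple.sort f ⟨s, hs⟩)) ↔ f i ≤ f (Tuple.sort f ⟨s, hs⟩) := by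
      rw [Prod.Lex.toLex_le_toLex]
    obtain ⟨k, rfl⟩ := (Tuple.sort f).surjective i
    rw [Finset.mem_filter, h2]
    simp only [Finset.mem_univ, true_and, Finset.mem_image, Finset.mem_Iic,
      (Tuple.sort f).injective.eq_iff, exists_eq_right]
    exact hmono.le_iff_le
  rw [h1, Finset.card_image_of_injective _ (Tuple.sort f).injective, Fin.card_Iic]

/-- The gap to the next integer decides whether a chip crosses it. Here the comparison with `θ` is
weak; in the ceiling version it is strict. -/
theorem floor_add_of_ceil_sub {y θ : ℝ} (hθ0 : 0 ≤ θ) (hθ1 : θ < 1) (q : ℤ) :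
    ⌊y + (q + θ)⌋ = ⌈y⌉ - 1 + (q + if ⌈y⌉ - y ≤ θ then 1 else 0) := by
  have h1 := Int.le_ceil y
  have h2 := Int.ceil_lt_add_one y
  rw [Int.floor_eq_iff]
  split_ifs with h
  · push_cast
    constructor <;> linarith
  · push Not at h
    push_cast
    constructor <;> linarith

theorem ceil_add_of_ceil_sub {y θ : ℝ} (hθ0 : 0 ≤ θ) (hθ1 : θ < 1) (q : ℤ) :
    ⌈y + (q + θ)⌉ = ⌈y⌉ + (q + if ⌈y⌉ - y < θ then 1 else 0) := by
  have h1 := Int.le_ceil y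
  have h2 := Int.ceil_lt_add_one y
  rw [Int.ceil_eq_iff]
  split_ifs with h
  · push_cast
    constructor <;> linarith
  · push Not at h
    push_cast
    constructor <;> linarith

theorem sum_erase_apply_zero {V : Type*} [Fintype V] [DecidableEq V] {m : ℕ}
    (σ : Fin (m + 1) ≃ V) (f : V → ℤ) :
    ∑ w ∈ Finset.univ.erase (σ 0), f w = ∑ i : Fin m, f (σ i.succ) := by
  have h1 := Finset.add_sum_erase Finset.univ f (Finset.mem_univ (σ 0))
  rw [← Equiv.sum_comp σ f, Fin.sum_univ_succ] at h1
  linarith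

theorem orderCoeff_symm_zero {V : Type*} [Fintype V] [DecidableEq V] (A : V → ℤ) (Y : V → V → ℝ)
    {m : ℕ} (σ : Fin (m + 1) ≃ V) : orderCoeff A Y (fun v => (σ.symm v : ℕ)) (σ 0) =
      A (σ 0) + ∑ w ∈ Finset.univ.erase (σ 0), ⌊Y w (σ 0)⌋ := by
  simp [orderCoeff, orderTerm]

/-- Firing the first vertex by a suitable real amount changes the coefficients in a suitable new
order by the almost constant amounts `q + ε i`. -/
theorem exists_shift_orderCoeff {V : Type*} [Fintype V] [DecidableEq V] (A : V → ℤ)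
    {Y : V → V → ℝ} (hY : IsPosition Y) {m : ℕ} (hm : 0 < m) (σ : Fin (m + 1) ≃ V) {c : ℤ}
    (hc : c = orderCoeff A Y (fun v => (σ.symm v : ℕ)) (σ 0)) (hc0 : 0 ≤ c) :
    ∃ (h : V → ℝ) (π : V → ℕ) (q : ℤ) (ε : Fin m → ℤ), Function.Injective π ∧ 0 ≤ q ∧
      (∀ i, 0 ≤ ε i ∧ ε i ≤ 1) ∧ ∑ i, (q + ε i) = c + 1 ∧
      orderCoeff A (fun v w => Y v w + (h v - h w)) π (σ 0) = -1 ∧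
      ∀ i : Fin m, orderCoeff A (fun v w => Y v w + (h v - h w)) π (σ i.succ) =
        orderCoeff A Y (fun v => (σ.symm v : ℕ)) (σ i.succ) + (q + ε i) := by
  have hmz : (0 : ℤ) < m := by exact_mod_cast hm
  set q := c / m with hq
  have hs0 := Int.emod_nonneg c hmz.ne'
  have hs1 := Int.emod_lt_of_pos c hmz
  have hcq := Int.mul_ediv_add_emod c m
  let y : Fin m → ℝ := fun i => Y (σ 0) (σ i.succ)
  let β : Fin m → ℝ := fun i => ⌈y i⌉ - y i
  -- With `θ` the gap of `j`, exactly `c % m + 1` of the `ε i` are 1, so the `q + ε i` add up to `c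
  -- + 1`.
  obtain ⟨j, hj⟩ := exists_card_filter_lex_le β (s := (c % m).toNat) (by omega)
  let θ := β j
  have hθ0 : 0 ≤ θ := by linarith [Int.le_ceil (y j)]
  have hθ1 : θ < 1 := by linarith [Int.ceil_lt_add_one (y j)]
  let ε : Fin m → ℤ := fun i => if β i < θ ∨ (β i = θ ∧ i ≤ j) then 1 else 0
  have hεsum : ∑ i, (q + ε i) = c + 1 := by
    rw [Finset.sum_add_distrib, Finset.sum_const, Finset.card_univ, Fintype.card_fin, nsmul_eq_mul,
      Finset.sum_boole, hj]
    push_cast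
    rw [Int.toNat_of_nonneg hs0]
    linarith
  let h : V → ℝ := fun v => if v = σ 0 then q + θ else 0
  -- The odd value `2 * j + 3` puts `σ 0` right after `σ j.succ`. Vertices up to `j` then see the
  -- weak comparison with `θ` and later ones the strict one, which is the tie-breaking in `ε`.
  let π : V → ℕ := fun v => if σ.symm v = 0 then 2 * j + 3 else 2 * (σ.symm v : ℕ)
  have hπ0 : π (σ 0) = 2 * j + 3 := by simp [π]
  have hπs : ∀ i : Fin m, π (σ i.succ) = 2 * i + 2 := by
    intro i
    simp only [π, σ.symm_apply_apply, Fin.succ_ne_zero, if_false, Fin.val_succ]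
    ring
  have hπ : Function.Injective π := by
    intro v w hvw
    obtain ⟨a, rfl⟩ := σ.surjective v
    obtain ⟨b, rfl⟩ := σ.surjective w
    congr 1
    cases a using Fin.cases with
    | zero =>
      cases b using Fin.cases with
      | zero => rfl
      | succ b => rw [hπ0, hπs] at hvw; omega
    | succ a =>
      cases b using Fin.cases with
      | zero => rw [hπ0, hπs] at hvw; omega
      | succ b =>
        rw [hπs, hπs] at hvw
        congr 1
        exact Fin.ext (by omega)
  set Y' : V → V → ℝ := fun v w => Y v w + (h v - h w) with hY'
  have hY'pos : IsPosition Y' := hY.shift h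
  have hne : ∀ i : Fin m, σ i.succ ≠ σ 0 := fun i => σ.injective.ne (Fin.succ_ne_zero i)
  have hsymm : Function.Injective fun v => (σ.symm v : ℕ) :=
    Fin.val_injective.comp σ.symm.injective
  have hterm0 : ∀ i, orderTerm Y' π (σ 0) (σ i.succ) =
      orderTerm Y (fun v => (σ.symm v : ℕ)) (σ 0) (σ i.succ) + (q + ε i) := by
    intro i
    have h1 : Y' (σ 0) (σ i.succ) = y i + (q + θ) := by
      simp [hY', h, hne, y]
    have h2 : orderTerm Y (fun v => (σ.symm v : ℕ)) (σ 0) (σ i.succ) = ⌈y i⌉ - 1 := by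
      simp [orderTerm, y]
    rw [h2, orderTerm, h1, hπ0, hπs]
    by_cases hij : i ≤ j
    · rw [if_neg (by rw [Fin.le_def] at hij; omega), floor_add_of_ceil_sub hθ0 hθ1]
      congr 2
      have : (⌈y i⌉ - y i ≤ θ) ↔ (β i < θ ∨ (β i = θ ∧ i ≤ j)) := by
        rw [le_iff_lt_or_eq]
        simp [hij, β]
      simp only [ε, this]
    · rw [if_pos (by rw [Fin.le_def] at hij; omega), ceil_add_of_ceil_sub hθ0 hθ1]
      have : (⌈y i⌉ - y i < θ) ↔ (β i < θ ∨ (β i = θ ∧ i ≤ j)) := by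
        simp [hij, β]
      simp only [ε, this]
      ring
  refine ⟨h, π, q, ε, hπ, Int.ediv_nonneg hc0 hmz.le, fun i => ?_, hεsum, ?_, fun i => ?_⟩
  · simp only [ε]
    split_ifs <;> norm_num
  · rw [orderCoeff] at hc ⊢
    rw [sum_erase_apply_zero] at hc ⊢
    have h1 : ∀ i : Fin m, orderTerm Y' π (σ i.succ) (σ 0) =
        orderTerm Y (fun v => (σ.symm v : ℕ)) (σ i.succ) (σ 0) - (q + ε i) := by
      intro i
      rw [hY'pos.orderTerm_antisymm hπ (hne i).symm, hY.orderTerm_antisymm hsymm (hne i).symm,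
        hterm0]
      ring
    rw [Finset.sum_congr rfl fun i _ => h1 i, Finset.sum_sub_distrib, hεsum]
    linarith
  · rw [orderCoeff, orderCoeff]
    have hmem : σ 0 ∈ Finset.univ.erase (σ i.succ) :=
      Finset.mem_erase.mpr ⟨(hne i).symm, Finset.mem_univ _⟩
    rw [← Finset.add_sum_erase _ _ hmem, ← Finset.add_sum_erase _ (fun w =>
      orderTerm Y (fun v => (σ.symm v : ℕ)) w (σ i.succ)) hmem, hterm0]
    have h1 : ∀ w ∈ (Finset.univ.erase (σ i.succ)).erase (σ 0), orderTerm Y' π w (σ i.succ) =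
        orderTerm Y (fun v => (σ.symm v : ℕ)) w (σ i.succ) := by
      intro w hw
      have hw0 : w ≠ σ 0 := Finset.ne_of_mem_erase hw
      obtain ⟨b, rfl⟩ := σ.surjective w
      obtain ⟨b, rfl⟩ := Fin.exists_succ_eq.mpr fun h : b = 0 => hw0 (by rw [h])
      have h2 : Y' (σ b.succ) (σ i.succ) = Y (σ b.succ) (σ i.succ) := by
        simp [hY', h, hne]
      have h3 : (π (σ b.succ) < π (σ i.succ)) ↔
          ((σ.symm (σ b.succ) : ℕ) < (σ.symm (σ i.succ) : ℕ)) := by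
        rw [hπs, hπs, σ.symm_apply_apply, σ.symm_apply_apply, Fin.val_succ, Fin.val_succ]
        omega
      simp only [orderTerm, h2, h3]
    rw [Finset.sum_congr rfl h1]
    ring

theorem orderCoeff_sub {V : Type*} [Fintype V] [DecidableEq V] (A B : V → ℤ) (Y : V → V → ℝ)
    (π : V → ℕ) (v : V) : orderCoeff (A - B) Y π v = orderCoeff A Y π v - B v := by
  simp only [orderCoeff, Pi.sub_apply]
  ring

/-! ### Lower bound for the degree, and reduction from edge points to vertices -/

section Bounds

open MetricGraph

variable {V : Type*} [LinearOrder V] [Fintype V] [Fintype (CompleteEdge V)]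

/-- A divisor whose class minus any effective divisor of degree `r` at the vertices is effective has
large degree. -/
theorem le_divisorDegree_of_rank {m : ℕ} (hm : Fintype.card V = m + 1)
    (D : (completeMetricGraph V).Point →₀ ℤ) {r : ℤ} (hr : 0 ≤ r)
    (hrank : ∀ E : V →₀ ℤ, 0 ≤ E → divisorDegree E = r →
      (linearSystem (completeMetricGraph V).LinEquiv
        (D - (completeMetricGraph V).vertexDivisor E)).Nonempty)
    {k : ℕ} (hk : k ≤ m) (hkr : k * (k + 1) ≤ 2 * r) :
    2 * r + 2 * k * m - k * (k + 1) ≤ 2 * divisorDegree D := by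
  have hV : Nonempty V := Fintype.card_pos_iff.mp (by omega)
  obtain ⟨A, Y₀, hY₀, hD₀, hdeg⟩ := exists_linEquiv_completeChip D
  obtain ⟨h₀, σ, hred⟩ := exists_reduced_order A Y₀ hm
  set Y : V → V → ℝ := fun v w => Y₀ v w + (h₀ v - h₀ w) with hYdef
  have hY : IsPosition Y := hY₀.shift h₀
  have hD : (completeMetricGraph V).LinEquiv D (completeChip A Y) :=
    hD₀.trans (completeChip_shift A Y₀ h₀)
  obtain ⟨-, hζ, hmono⟩ := hred Y rfl
  have hsymm : Function.Injective fun v => (σ.symm v : ℕ) :=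
    Fin.val_injective.comp σ.symm.injective
  have hX : ∀ (Y' : V → V → ℝ) (π : V → ℕ) (E : V →₀ ℤ), IsPosition Y' → Function.Injective π →
      (completeMetricGraph V).LinEquiv D (completeChip A Y') → 0 ≤ E →
      (∀ v, orderCoeff A Y' π v - E v ≤ -1) → r < divisorDegree E := by
    intro Y' π E hY' hπ hDY' hE hle
    by_contra! hcon
    let o : V := Classical.arbitrary V
    -- If deg `E` were at most `r`, padding `E` to degree `r` at any vertex would contradict
    -- `hrank`.
    let E' := E + Finsupp.single o (r - divisorDegree E)
    have hEE' : E ≤ E' := by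
      refine le_add_of_nonneg_right ?_
      rw [Finsupp.single_nonneg]
      linarith
    have h1 := hrank E' (hE.trans hEE') (by
      simp only [E', divisorDegree_add, divisorDegree_single]
      ring)
    refine h1.ne_empty (linearSystem_eq_empty_of_linEquiv (hDY'.sub_right _) ?_)
    rw [← completeChip_sub]
    refine completeChip_linearSystem_eq_empty hY' hπ fun v => ?_
    rw [Finsupp.coe_sub, orderCoeff_sub]
    linarith [hle v, hEE' v]
  set π₀ : V → ℕ := fun v => (σ.symm v : ℕ) with hπ₀
  set c := orderCoeff A Y π₀ (σ 0) with hc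
  have hcard := card_completeEdge (V := V)
  rw [hm] at hcard
  push_cast at hcard
  have hdegA : divisorDegree A = c + ∑ i : Fin m, orderCoeff A Y π₀ (σ i.succ) := by
    rw [divisorDegree_eq_sum, ← hY.sum_orderCoeff A hsymm, ← Equiv.sum_comp σ,
      Fin.sum_univ_succ]
  have hc0 : 0 ≤ c := by
    by_contra! hneg
    have h1 := hX Y π₀ 0 hY hsymm hD le_rfl fun v => by
      obtain ⟨i, rfl⟩ := σ.surjective v
      rw [Finsupp.coe_zero, Pi.zero_apply, sub_zero]
      by_cases hi : i = 0
      · rw [hi]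
        omega
      · exact (hζ i hi).1
    rw [divisorDegree_zero] at h1
    linarith
  -- A single vertex has no neighbour to receive chips, so `E` is taken directly to be `c + 1` times
  -- that vertex.
  rcases Nat.eq_zero_or_pos m with hm0 | hm0
  · subst hm0
    have h1 := hX Y π₀ (Finsupp.single (σ 0) (c + 1)) hY hsymm hD
      (by rw [Finsupp.single_nonneg]; linarith) fun v => by
        obtain ⟨i, rfl⟩ := σ.surjective v
        obtain rfl : i = 0 := Fin.ext (by omega)
        rw [Finsupp.single_eq_same]
        linarith
    rw [divisorDegree_single] at h1
    obtain rfl : k = 0 := by omega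
    simp at hdegA hcard
    rw [hdeg, hdegA, hcard]
    push_cast
    linarith
  obtain ⟨h, π, q, ε, hπ, hq0, hε, hεsum, hz, hs⟩ :=
    exists_shift_orderCoeff (⇑A) hY hm0 σ hc hc0
  set ζ : Fin m → ℤ := fun i => orderCoeff A Y π₀ (σ i.succ) with hζdef
  -- The least effective divisor whose subtraction brings every coefficient down to at most -1; the
  -- coefficient at `σ 0` is already -1.
  let E : V →₀ ℤ := Finsupp.equivFunOnFinite.symm fun v =>
    Fin.cases 0 (fun i => max 0 (ζ i + (q + ε i) + 1)) (σ.symm v)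
  have hE0 : E (σ 0) = 0 := by simp [E]
  have hEs : ∀ i : Fin m, E (σ i.succ) = max 0 (ζ i + (q + ε i) + 1) := fun i => by simp [E]
  have hP := hX _ π E (hY.shift h) hπ (hD.trans (completeChip_shift A Y h))
    (fun v => by
      obtain ⟨i, rfl⟩ := σ.surjective v
      cases i using Fin.cases with
      | zero => rw [hE0]; rfl
      | succ i => rw [hEs]; exact le_max_left _ _)
    fun v => by
      obtain ⟨i, rfl⟩ := σ.surjective v
      cases i using Fin.cases with
      | zero => rw [hE0, hz]; norm_num
      | succ i =>
        rw [hEs, hs]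
        linarith [le_max_right 0 (ζ i + (q + ε i) + 1)]
  have hdegE : divisorDegree E = ∑ i : Fin m, max 0 (ζ i + (q + ε i) + 1) := by
    rw [divisorDegree_eq_sum, ← Equiv.sum_comp σ, Fin.sum_univ_succ, hE0, zero_add]
    exact Finset.sum_congr rfl fun i _ => hEs i
  -- The index `n` stands for `σ` at `n + 1`, so the bounds on reduced coefficients become `0 ≤ z' n
  -- ≤ n`.
  let z' : ℕ → ℤ := fun n => if hn : n < m then ζ ⟨n, hn⟩ + (n + 1) else 0
  let ε' : ℕ → ℤ := fun n => if hn : n < m then ε ⟨n, hn⟩ else 0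
  have hmain := sum_ge_of_lt_sum hk z' ε' hq0
    (fun i j hij hj => by
      have h1 := hmono (Fin.succ ⟨i, hij.trans_lt hj⟩) (Fin.succ ⟨j, hj⟩) (Fin.succ_ne_zero _)
        (by simpa [Fin.le_def] using hij)
      simpa [z', hj, hij.trans_lt hj, hζdef] using h1)
    (fun i hi => by
      have h1 := (hζ (Fin.succ ⟨i, hi⟩) (Fin.succ_ne_zero _)).2
      simp only [Fin.val_succ, Nat.cast_add, Nat.cast_one] at h1
      simp only [z', hi, dif_pos, hζdef]
      linarith)
    (fun i hi => by
      have h1 := (hζ (Fin.succ ⟨i, hi⟩) (Fin.succ_ne_zero _)).1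
      simp only [z', hi, dif_pos, hζdef]
      linarith)
    (fun i hi => by simpa only [ε', hi, dif_pos] using hε _)
    (P := divisorDegree E) (by
      rw [hdegE, Finset.sum_range]
      refine Finset.sum_congr rfl fun i _ => ?_
      simp only [z', ε', i.isLt, dif_pos, Fin.eta]
      congr 1
      ring)
    (by linarith)
  have hsum : ∑ i ∈ Finset.range m, (q + ε' i + z' i) =
      c + 1 + ∑ i, ζ i + ∑ i ∈ Finset.range m, ((i : ℤ) + 1) := by
    rw [← hεsum, ← Finset.sum_add_distrib, Finset.sum_range, Finset.sum_range,
      ← Finset.sum_add_distrib]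
    refine Finset.sum_congr rfl fun i _ => ?_
    simp only [z', ε', i.isLt, dif_pos, Fin.eta]
    ring
  have hgauss := two_mul_sum_range m
  have hsplit : ∑ i ∈ Finset.range m, ((i : ℤ) + 1) = ∑ i ∈ Finset.range m, (i : ℤ) + m := by
    rw [Finset.sum_add_distrib]
    simp
  rw [hsplit] at hsum
  rw [hdeg, hdegA]
  rw [hsum] at hmain
  linarith

/-- If a divisor class remains effective after subtracting either endpoint of an edge, it does so
after subtracting any point of the edge. -/
theorem linearSystem_sub_interior_nonempty {m : ℕ} (hm : Fintype.card V = m + 1)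
    (D : (completeMetricGraph V).Point →₀ ℤ) (e : CompleteEdge V) {t : ℝ}
    (ht : t ∈ Ioo 0 ((completeMetricGraph V).len e))
    (hsrc : (linearSystem (completeMetricGraph V).LinEquiv
      (D - Finsupp.single (Point.vertex e.1.1) 1)).Nonempty)
    (htgt : (linearSystem (completeMetricGraph V).LinEquiv
      (D - Finsupp.single (Point.vertex e.1.2) 1)).Nonempty) :
    (linearSystem (completeMetricGraph V).LinEquiv
      (D - Finsupp.single (Point.interior e t ht) 1)).Nonempty := by
  have hV : Nonempty V := Fintype.card_pos_iff.mp (by omega)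
  obtain ⟨A, Y₀, hY₀, hD₀, -⟩ :=
    exists_linEquiv_completeChip (D - Finsupp.single (Point.interior e t ht) 1)
  obtain ⟨h₀, σ, hred⟩ := exists_reduced_order A Y₀ hm
  set Y : V → V → ℝ := fun v w => Y₀ v w + (h₀ v - h₀ w) with hYdef
  have hY : IsPosition Y := hY₀.shift h₀
  have hD := hD₀.trans (completeChip_shift A Y₀ h₀)
  obtain ⟨hpos, hζ, -⟩ := hred Y rfl
  set π : V → ℕ := fun v => (σ.symm v : ℕ) with hπdef
  have hπ : Function.Injective π := Fin.val_injective.comp σ.symm.injective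
  -- If the coefficient at the base vertex is nonnegative, the reduced representative is effective.
  -- Otherwise the burning order certifies that the class is not.
  by_cases hc : 0 ≤ orderCoeff A Y π (σ 0)
  · refine ⟨completeChip A Y, completeChip_nonneg hY fun v => ?_, hD.symm⟩
    by_cases hv : v = σ 0
    · rwa [hv, ← orderCoeff_symm_zero]
    · exact hpos v hv
  exfalso
  have hle : ∀ v, orderCoeff A Y π v ≤ -1 := by
    intro v
    obtain ⟨i, rfl⟩ := σ.surjective v
    by_cases hi : i = 0
    · rw [hi]
      omega
    · exact (hζ i hi).1
  obtain ⟨Y', hY', hadd, hYe, hYne⟩ := single_add_completeChip A hY e ht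
  have hD' : (completeMetricGraph V).LinEquiv D
      (completeChip (A + Finsupp.single e.1.1 1) Y') := by
    refine LinEquiv.trans ?_ hadd
    have := hD.add_right (Finsupp.single (Point.interior e t ht) 1)
    rwa [sub_add_cancel, add_comm (completeChip A _)] at this
  have hne : e.1.1 ≠ e.1.2 := ne_of_lt e.2.2
  have ht1 : t < 1 := ht.2
  -- Restoring the interior point moves the chip of `e` by less than a full edge, so at most one
  -- chip crosses. According to `δ`, subtracting the source or the target gives back the old
  -- coefficients, and the same order is a certificate.
  set δ := orderTerm Y' π e.1.1 e.1.2 - orderTerm Y π e.1.1 e.1.2 with hδ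
  have hδ01 : δ = 0 ∨ δ = 1 := by
    have h1 := ht.1
    suffices 0 ≤ δ ∧ δ ≤ 1 by omega
    rw [hδ, orderTerm, orderTerm, hYe]
    split_ifs
    · have h2 : ⌈Y e.1.1 e.1.2⌉ ≤ ⌈Y e.1.1 e.1.2 + t⌉ := Int.ceil_le_ceil (by linarith)
      have h3 : ⌈Y e.1.1 e.1.2 + t⌉ ≤ ⌈Y e.1.1 e.1.2⌉ + 1 := by
        rw [← Int.ceil_add_one]
        exact Int.ceil_le_ceil (by linarith)
      omega
    · have h2 : ⌊Y e.1.1 e.1.2⌋ ≤ ⌊Y e.1.1 e.1.2 + t⌋ := Int.floor_le_floor (by linarith)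
      have h3 : ⌊Y e.1.1 e.1.2 + t⌋ ≤ ⌊Y e.1.1 e.1.2⌋ + 1 := by
        rw [← Int.floor_add_one]
        exact Int.floor_le_floor (by linarith)
      omega
  have hδ' : orderTerm Y' π e.1.2 e.1.1 = orderTerm Y π e.1.2 e.1.1 - δ := by
    rw [hY'.orderTerm_antisymm hπ hne, hY.orderTerm_antisymm hπ hne, hδ]
    ring
  have hterm : ∀ v w, (w, v) ≠ e.1 → (v, w) ≠ e.1 → orderTerm Y' π w v = orderTerm Y π w v := by
    intro v w h1 h2
    simp only [orderTerm, hYne w v h1 h2]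
  have hcoeff : ∀ v, orderCoeff A Y' π v = orderCoeff A Y π v +
      ((if v = e.1.2 then δ else 0) - if v = e.1.1 then δ else 0) := by
    intro v
    rw [orderCoeff, orderCoeff, add_assoc]
    congr 1
    by_cases hv2 : v = e.1.2
    · have hmem : e.1.1 ∈ Finset.univ.erase v := by simp [hv2, hne]
      rw [← Finset.add_sum_erase _ _ hmem, ← Finset.add_sum_erase _ (fun w =>
        orderTerm Y π w v) hmem, Finset.sum_congr rfl fun w hw => hterm v w ?_ ?_, if_pos hv2,
        if_neg (by rw [hv2]; exact hne.symm)]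
      · rw [hv2]
        linarith
      · intro h
        exact Finset.ne_of_mem_erase hw (congrArg Prod.fst h)
      · intro h
        exact hne (by rw [← hv2]; exact (congrArg Prod.fst h).symm)
    · rw [if_neg hv2]
      by_cases hv1 : v = e.1.1
      · have hmem : e.1.2 ∈ Finset.univ.erase v := by simp [hv1, hne.symm]
        rw [← Finset.add_sum_erase _ _ hmem, ← Finset.add_sum_erase _ (fun w =>
          orderTerm Y π w v) hmem, Finset.sum_congr rfl fun w hw => hterm v w ?_ ?_, if_pos hv1]
        · rw [hv1]
          linarith
        · intro h
          exact hv2 (congrArg Prod.snd h)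
        · intro h
          exact Finset.ne_of_mem_erase hw (congrArg Prod.snd h)
      · rw [if_neg hv1, Finset.sum_congr rfl fun w _ => hterm v w
          (fun h => hv2 (congrArg Prod.snd h)) fun h => hv1 (congrArg Prod.fst h)]
        ring
  rcases hδ01 with hδ0 | hδ1
  · refine hsrc.ne_empty (linearSystem_eq_empty_of_linEquiv (hD'.sub_right _) ?_)
    rw [← vertexDivisor_single, ← completeChip_sub, add_sub_cancel_right]
    refine completeChip_linearSystem_eq_empty hY' hπ fun v => ?_
    rw [hcoeff, hδ0]
    simpa using hle v
  · refine htgt.ne_empty (linearSystem_eq_empty_of_linEquiv (hD'.sub_right _) ?_)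
    rw [← vertexDivisor_single, ← completeChip_sub]
    refine completeChip_linearSystem_eq_empty hY' hπ fun v => ?_
    have h1 : orderCoeff (A + Finsupp.single e.1.1 1 - Finsupp.single e.1.2 1 : V →₀ ℤ) Y' π v =
        orderCoeff A Y π v := by
      have h2 := hcoeff v
      simp only [orderCoeff, hδ1, Finsupp.coe_sub, Finsupp.coe_add, Pi.sub_apply, Pi.add_apply,
        Finsupp.single_apply, eq_comm (b := v)] at h2 ⊢
      linarith
    rw [h1]
    exact hle v

end Bounds

end

section

open Set Filter Topology

/-! ### Explicit divisors of the required rank on the finite graph -/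

section Upper

variable {V : Type*} [Fintype V]

/-- The divisor with coefficient `1` at every vertex. -/
noncomputable def allVertices (V : Type*) [Fintype V] : V →₀ ℤ := Finsupp.equivFunOnFinite.symm 1

theorem allVertices_apply (v : V) : allVertices V v = 1 := rfl

theorem divisorDegree_allVertices : divisorDegree (allVertices V) = Fintype.card V := by
  simp [divisorDegree_eq_sum, allVertices_apply]

theorem le_divisorDegree_of_nonneg {P : Type*} {E : P →₀ ℤ} (hE : 0 ≤ E) (p : P) :
    E p ≤ divisorDegree E := by
  by_cases hp : p ∈ E.support
  · exact Finset.single_le_sum (f := fun p => E p) (fun q _ => hE q) hp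
  · rw [Finsupp.notMem_support_iff.mp hp]
    exact Finset.sum_nonneg fun q _ => hE q

theorem sub_single_nonneg {P : Type*} {E : P →₀ ℤ} (hE : 0 ≤ E) {p : P} {n : ℤ} (hn : n ≤ E p) :
    0 ≤ E - Finsupp.single p n := by
  classical
  intro q
  rw [Finsupp.sub_apply, Finsupp.single_apply, Finsupp.coe_zero, Pi.zero_apply]
  have := hE q
  rw [Finsupp.coe_zero, Pi.zero_apply] at this
  split_ifs with h
  · subst h
    linarith
  · linarith

theorem effective_of_le {P : (V →₀ ℤ) → Prop} (hP0 : ∀ A, 0 ≤ A → P A)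
    {k : ℤ} {E : V →₀ ℤ} (h : ∀ v, E v ≤ k) :
    P (k • allVertices V - E) := by
  refine hP0 _ fun v => ?_
  simp only [Finsupp.coe_zero, Pi.zero_apply, Finsupp.sub_apply, Finsupp.smul_apply,
    allVertices_apply, smul_eq_mul]
  linarith [h v]

/-- `P` stands for being equivalent to an effective divisor. In the step to `k + 1`, a vertex with
at least `k + 2` chips of `E` gives up `k + 2`, lowering the bound on deg `E` from (k+1)(k+4)/2 to
k(k+3)/2. Firing restores one chip everywhere at the cost of `Fintype.card V` at that vertex, of
which all but `k + 2` are added back. -/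
theorem effective_of_degree_le {P : (V →₀ ℤ) → Prop}
    (hP0 : ∀ A, 0 ≤ A → P A)
    (hPH : ∀ A v, P A → P (A + allVertices V - Finsupp.single v (Fintype.card V : ℤ)))
    (hPadd : ∀ A B, P A → 0 ≤ B → P (A + B)) (k : ℕ)
    (hk : k + 1 ≤ Fintype.card V) (E : V →₀ ℤ) (hE : 0 ≤ E)
    (hdeg : 2 * divisorDegree E ≤ k * (k + 3)) : P ((k : ℤ) • allVertices V - E) := by
  induction k generalizing E with
  | zero =>
    refine effective_of_le hP0 fun v => ?_
    have := le_divisorDegree_of_nonneg hE v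
    push_cast at hdeg ⊢
    linarith
  | succ k ih =>
    by_cases h : ∀ v, E v ≤ (k + 1 : ℕ)
    · exact effective_of_le hP0 h
    push Not at h
    obtain ⟨v, hv⟩ := h
    have h1 := ih (by omega) (E - Finsupp.single v ((k : ℤ) + 2)) (sub_single_nonneg hE (by
      push_cast at hv
      linarith)) (by
      rw [divisorDegree_sub, divisorDegree_single]
      push_cast at hdeg
      linarith)
    have h2 := hPH _ v (hPadd _ (Finsupp.single v ((Fintype.card V : ℤ) - (k + 2))) h1 (by
      rw [Finsupp.single_nonneg]
      have : ((k + 1 + 1 : ℕ) : ℤ) ≤ Fintype.card V := by exact_mod_cast hk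
      push_cast at this
      linarith))
    refine cast (congrArg P ?_) h2
    ext w
    simp only [Finsupp.sub_apply, Finsupp.add_apply, Finsupp.smul_apply, allVertices_apply,
      smul_eq_mul, Finsupp.single_sub]
    push_cast
    ring

/-- The hypothesis says that the divisor has degree at least the genus. The base case is the
previous lemma; afterwards an excessive coefficient is at least `Fintype.card V` and is removed by
one firing. -/
theorem effective_of_degree_le_of_card_le {P : (V →₀ ℤ) → Prop}
    (hP0 : ∀ A, 0 ≤ A → P A)
    (hPH : ∀ A v, P A → P (A + allVertices V - Finsupp.single v (Fintype.card V : ℤ)))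
    (hPadd : ∀ A B, P A → 0 ≤ B → P (A + B)) (k : ℕ)
    (hV : 0 < Fintype.card V)
    (hk : Fintype.card V - 2 ≤ k) (E : V →₀ ℤ) (hE : 0 ≤ E)
    (hdeg : 2 * divisorDegree E ≤
      2 * k * Fintype.card V - (Fintype.card V - 1) * (Fintype.card V - 2)) :
    P ((k : ℤ) • allVertices V - E) := by
  induction k, hk using Nat.le_induction generalizing E with
  | base =>
    refine effective_of_degree_le hP0 hPH hPadd _ (by omega) E hE (hdeg.trans (le_of_eq ?_))
    rcases Nat.lt_or_ge 1 (Fintype.card V) with h | h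
    · rw [Nat.cast_sub h]
      push_cast
      ring
    · have : Fintype.card V = 1 := by omega
      simp [this]
  | succ k hk ih =>
    by_cases h : ∀ v, E v ≤ (k + 1 : ℕ)
    · exact effective_of_le hP0 h
    push Not at h
    obtain ⟨v, hv⟩ := h
    have h3 : (Fintype.card V : ℤ) ≤ E v := by omega
    have h1 := ih (E - Finsupp.single v (Fintype.card V : ℤ)) (sub_single_nonneg hE h3) (by
      rw [divisorDegree_sub, divisorDegree_single]
      push_cast at hdeg
      linarith)
    refine cast (congrArg P ?_) (hPH _ v h1)
    ext w
    simp only [Finsupp.sub_apply, Finsupp.add_apply, Finsupp.smul_apply, allVertices_apply,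
      smul_eq_mul]
    push_cast
    ring

/-- The divisor is `K` times the sum of the vertices minus `h` times one vertex. For small `r`, `K =
k` and `r + h = k(k+3)/2`, the largest degree allowed by `effective_of_degree_le`. -/
theorem exists_divisor_of_rank {P : (V →₀ ℤ) → Prop}
    (hP0 : ∀ A, 0 ≤ A → P A)
    (hPH : ∀ A v, P A → P (A + allVertices V - Finsupp.single v (Fintype.card V : ℤ)))
    (hPadd : ∀ A B, P A → 0 ≤ B → P (A + B)) {m k : ℕ}
    (hm : Fintype.card V = m + 1) (hk : k ≤ m) {r s : ℤ} (hr : 0 ≤ r)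
    (hs : 2 * s = 2 * r + 2 * k * m - k * (k + 1))
    (hkr : 2 * r ≤ k * (k + 3) ∨ k + 1 = m ∨ m = 0) :
    ∃ A : V →₀ ℤ, divisorDegree A = s ∧ ∀ E, 0 ≤ E → divisorDegree E = r → P (A - E) := by
  obtain ⟨o⟩ : Nonempty V := Fintype.card_pos_iff.mp (by omega)
  have hmz : (Fintype.card V : ℤ) = m + 1 := by exact_mod_cast hm
  suffices H : ∃ (K : ℕ) (h : ℤ), 0 ≤ h ∧ K * (m + 1) - h = s ∧
      ∀ E : V →₀ ℤ, 0 ≤ E → divisorDegree E = r + h → P ((K : ℤ) • allVertices V - E) by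
    obtain ⟨K, h, h0, hKs, hK⟩ := H
    refine ⟨(K : ℤ) • allVertices V - Finsupp.single o h, ?_, fun E hE hdE => ?_⟩
    · rw [divisorDegree_sub, divisorDegree_smul, divisorDegree_allVertices, divisorDegree_single,
        hmz, hKs]
    · rw [sub_sub]
      refine hK _ (add_nonneg (Finsupp.single_nonneg.mpr h0) hE) ?_
      rw [divisorDegree_add, divisorDegree_single, hdE, add_comm]
  rcases hkr with hkr | hkr
  · refine ⟨k, k * (m + 1) - s, by linarith, by ring, fun E hE hdE => ?_⟩
    refine effective_of_degree_le hP0 hPH hPadd k (by omega) E hE ?_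
    rw [hdE]
    linarith
  · have hkm : 2 * (k : ℤ) * m - k * (k + 1) = m * (m - 1) := by
      rcases hkr with h | h
      · have : (m : ℤ) = k + 1 := by exact_mod_cast h.symm
        rw [this]
        ring
      · subst h
        obtain rfl : k = 0 := by omega
        simp
    have hm2 : (0 : ℤ) ≤ m * (m - 1) := by
      rcases Nat.eq_zero_or_pos m with h | h
      · simp [h]
      · have : (1 : ℤ) ≤ m := by exact_mod_cast h
        nlinarith
    have hs0 : 0 ≤ s := by linarith
    -- Any `K ≥ m - 1` making `h` nonnegative would do: after subtracting `E` the degree is `s - r`,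
    -- the genus.
    refine ⟨m + s.toNat, (m + s.toNat : ℕ) * (m + 1) - s, ?_, by ring, fun E hE hdE => ?_⟩
    · push_cast
      rw [Int.toNat_of_nonneg hs0]
      nlinarith
    · refine effective_of_degree_le_of_card_le hP0 hPH hPadd _ (by omega) (by omega) E hE ?_
      rw [hdE, hmz]
      linarith

end Upper

/-! ### From bounds to the gonality sequence -/

section Gonality

/-- The lower bound is needed for all `n ≥ r`: it forces the rank of the given divisor to be exactly
`r`, since a larger rank would cost a larger degree. -/
theorem isGonality_of_bounds {P : Type*} {equiv : (P →₀ ℤ) → (P →₀ ℤ) → Prop} (p : P)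
    (hadd : ∀ A B C, equiv A B → equiv (A + C) (B + C)) {r s : ℤ} (hr : 0 ≤ r)
    (hex : ∃ D : P →₀ ℤ, divisorDegree D = s ∧
      ∀ E, 0 ≤ E → divisorDegree E = r → (linearSystem equiv (D - E)).Nonempty)
    (hlow : ∀ (n : ℤ) (D : P →₀ ℤ), r ≤ n →
      (∀ E, 0 ≤ E → divisorDegree E = n → (linearSystem equiv (D - E)).Nonempty) →
      s + (n - r) ≤ divisorDegree D) : IsGonality equiv r s := by
  constructor
  · obtain ⟨D, hD, hE⟩ := hex
    refine ⟨D, hD, Or.inr ⟨?_, ⟨hr, hE⟩, ?_⟩⟩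
    · obtain ⟨A, hA, hAD⟩ := hE (Finsupp.single p r) (Finsupp.single_nonneg.mpr hr)
        (divisorDegree_single p r)
      refine ⟨A + Finsupp.single p r, add_nonneg hA (Finsupp.single_nonneg.mpr hr), ?_⟩
      simpa using hadd _ _ (Finsupp.single p r) hAD
    · rintro n ⟨-, hn⟩
      by_contra! hrn
      have := hlow n D hrn.le hn
      linarith
  · rintro n ⟨D, hD, hrank⟩
    rcases hrank with ⟨-, h⟩ | ⟨-, ⟨-, h⟩, -⟩
    · linarith
    · have := hlow r D le_rfl h
      linarith

end Gonality

/-! ### Linear equivalence on the finite complete graph -/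

section CompleteGraph

variable {V : Type*} [Fintype V] [DecidableRel (SimpleGraph.completeGraph V).Adj]

theorem completeGraph_divCoeff [DecidableEq V] (f : V → ℤ) (v : V) :
    (SimpleGraph.completeGraph V).divCoeff f v = ∑ w ∈ Finset.univ.erase v, (f v - f w) := by
  rw [SimpleGraph.divCoeff]
  refine Finset.sum_congr ?_ fun _ _ => rfl
  ext w
  simp [eq_comm]

theorem completeGraph_linEquiv_add {A B : V →₀ ℤ} (C : V →₀ ℤ)
    (h : (SimpleGraph.completeGraph V).LinEquiv A B) :
    (SimpleGraph.completeGraph V).LinEquiv (A + C) (B + C) := by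
  obtain ⟨f, hf⟩ := h
  exact ⟨f, fun v => by rw [← hf]; simp⟩

theorem completeGraph_linEquiv_refl (A : V →₀ ℤ) :
    (SimpleGraph.completeGraph V).LinEquiv A A :=
  ⟨0, fun v => by simp [SimpleGraph.divCoeff]⟩

theorem completeGraph_linEquiv_trans {A B C : V →₀ ℤ}
    (h : (SimpleGraph.completeGraph V).LinEquiv A B)
    (h' : (SimpleGraph.completeGraph V).LinEquiv B C) :
    (SimpleGraph.completeGraph V).LinEquiv A C := by
  obtain ⟨f, hf⟩ := h
  obtain ⟨g, hg⟩ := h'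
  refine ⟨f + g, fun v => ?_⟩
  have h1 : (A - C) v = (A - B) v + (B - C) v := by simp
  rw [h1, hf, hg, SimpleGraph.divCoeff, SimpleGraph.divCoeff, SimpleGraph.divCoeff,
    ← Finset.sum_add_distrib]
  refine Finset.sum_congr rfl fun w _ => ?_
  simp only [Pi.add_apply]
  ring

theorem completeGraph_linEquiv_allVertices [DecidableEq V] (A : V →₀ ℤ) (v : V) :
    (SimpleGraph.completeGraph V).LinEquiv A
      (A + allVertices V - Finsupp.single v (Fintype.card V : ℤ)) := by
  refine ⟨Pi.single v 1, fun w => ?_⟩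
  rw [completeGraph_divCoeff]
  simp only [Finsupp.sub_apply, Finsupp.add_apply, allVertices_apply, Finset.sum_sub_distrib,
    Finset.sum_const, Finset.card_erase_of_mem (Finset.mem_univ w), Finset.card_univ, nsmul_eq_mul]
  have hc : 0 < Fintype.card V := Fintype.card_pos_iff.mpr ⟨v⟩
  rw [Nat.cast_sub hc]
  by_cases h : w = v
  · subst h
    have h0 : ∀ u ∈ Finset.univ.erase w, (Pi.single w (1 : ℤ) : V → ℤ) u = 0 := fun u hu =>
      Pi.single_eq_of_ne (Finset.ne_of_mem_erase hu) _
    rw [Finset.sum_eq_zero h0]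
    simp
    ring
  · rw [Finset.sum_eq_single_of_mem v (Finset.mem_erase.mpr ⟨Ne.symm h, Finset.mem_univ v⟩)
      fun u _ hu => by simp [hu]]
    simp [h]

end CompleteGraph

/-! ### Transfer between the finite and the metric graph -/

section Complete

open MetricGraph

variable {V : Type*} [LinearOrder V] [Fintype V] [Fintype (CompleteEdge V)]

/-- The vertices form a rank-determining set. -/
theorem linearSystem_sub_nonempty_of_vertex {m : ℕ} (hm : Fintype.card V = m + 1)
    (D : (completeMetricGraph V).Point →₀ ℤ) {r : ℤ}
    (h : ∀ B : V →₀ ℤ, 0 ≤ B → divisorDegree B = r →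
      (linearSystem (completeMetricGraph V).LinEquiv
        (D - (completeMetricGraph V).vertexDivisor B)).Nonempty)
    (E : (completeMetricGraph V).Point →₀ ℤ) (hE : 0 ≤ E) (hdE : divisorDegree E = r) :
    (linearSystem (completeMetricGraph V).LinEquiv (D - E)).Nonempty := by
  -- The points of `E` are traded one at a time for vertices collected in `B`, the total degree
  -- staying `r`.
  suffices H : ∀ (n : ℕ) (E : (completeMetricGraph V).Point →₀ ℤ) (B : V →₀ ℤ), 0 ≤ E → 0 ≤ B →
      divisorDegree E = n → divisorDegree E + divisorDegree B = r →
      (linearSystem (completeMetricGraph V).LinEquiv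
        (D - (completeMetricGraph V).vertexDivisor B - E)).Nonempty by
    have h0 : 0 ≤ divisorDegree E := Finset.sum_nonneg fun q _ => hE q
    have := H (divisorDegree E).toNat E 0 hE le_rfl (Int.toNat_of_nonneg h0).symm
      (by rw [divisorDegree_zero, hdE, add_zero])
    rwa [vertexDivisor_zero, sub_zero] at this
  intro n
  induction n with
  | zero =>
    intro E B hE hB hdE hdB
    have hE0 : E = 0 := by
      ext p
      have h1 := le_divisorDegree_of_nonneg hE p
      have h2 := hE p
      rw [hdE] at h1
      exact le_antisymm (by simpa using h1) h2
    rw [hE0, sub_zero]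
    refine h B hB ?_
    rw [← hdB, hdE]
    simp
  | succ n ih =>
    intro E B hE hB hdE hdB
    obtain ⟨p, hp⟩ : ∃ p, 1 ≤ E p := by
      by_contra! hc
      have : E = 0 := by
        ext p
        exact le_antisymm (by have := hc p; simp; omega) (hE p)
      rw [this, divisorDegree_zero] at hdE
      push_cast at hdE
      linarith
    set E' := E - Finsupp.single p 1 with hE'
    have hE'0 : 0 ≤ E' := sub_single_nonneg hE hp
    have hdE' : divisorDegree E' = n := by
      rw [hE', divisorDegree_sub, divisorDegree_single, hdE]
      push_cast
      ring
    have hstep : ∀ v, (linearSystem (completeMetricGraph V).LinEquiv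
        (D - (completeMetricGraph V).vertexDivisor B - E' -
          Finsupp.single (Point.vertex v) 1)).Nonempty := by
      intro v
      have h1 := ih E' (B + Finsupp.single v 1) hE'0
        (add_nonneg hB (Finsupp.single_nonneg.mpr zero_le_one)) hdE' (by
          rw [divisorDegree_add, divisorDegree_single, ← hdB, hdE', hdE]
          push_cast
          ring)
      rw [vertexDivisor_add, vertexDivisor_single] at h1
      refine cast ?_ h1
      congr 2
      abel
    have hEE' : D - (completeMetricGraph V).vertexDivisor B - E =
        D - (completeMetricGraph V).vertexDivisor B - E' - Finsupp.single p 1 := by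
      rw [hE']
      abel
    rw [hEE']
    cases p with
    | vertex v => exact hstep v
    | interior e t ht =>
      exact linearSystem_sub_interior_nonempty hm _ e ht (hstep _) (hstep _)

variable [DecidableRel (SimpleGraph.completeGraph V).Adj]

/-- A function on the vertices is interpolated linearly along the edges: one ramp of full length per
edge. -/
theorem vertexDivisor_linEquiv {A B : V →₀ ℤ} (h : (SimpleGraph.completeGraph V).LinEquiv A B) :
    (completeMetricGraph V).LinEquiv ((completeMetricGraph V).vertexDivisor A)
      ((completeMetricGraph V).vertexDivisor B) := by
  obtain ⟨f, hf⟩ := h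
  refine linEquiv_of_ramps (ι := CompleteEdge V) id (fun _ => 1) (fun _ => ⟨zero_le_one, le_rfl⟩)
    (fun e => f e.1.2 - f e.1.1) (fun v => f v) (fun e => ?_) ?_
  · simp [rampSum, SimpleGraph.toMetricGraph]
  · have h1 : A - B = ∑ e : CompleteEdge V, (Finsupp.single e.1.2 (f e.1.2 - f e.1.1) +
        Finsupp.single e.1.1 (f e.1.1 - f e.1.2)) := by
      ext v
      rw [sum_completeEdge fun w v => f v - f w, hf, completeGraph_divCoeff]
    rw [← vertexDivisor_sub, h1, vertexDivisor_sum]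
    refine Finset.sum_congr rfl fun e _ => ?_
    have h2 : (completeMetricGraph V).edgePoint e 1 = Point.vertex e.1.2 :=
      edgePoint_len (Γ := completeMetricGraph V) e
    rw [id, h2, vertexDivisor_add, vertexDivisor_single, vertexDivisor_single, smul_sub,
      Finsupp.smul_single, Finsupp.smul_single]
    simp only [SimpleGraph.toMetricGraph, smul_eq_mul, mul_one, Finsupp.single_sub]
    abel

theorem linearSystem_vertexDivisor_nonempty {A : V →₀ ℤ}
    (h : (linearSystem (SimpleGraph.completeGraph V).LinEquiv A).Nonempty) :
    (linearSystem (completeMetricGraph V).LinEquiv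
      ((completeMetricGraph V).vertexDivisor A)).Nonempty := by
  obtain ⟨B, hB, hBA⟩ := h
  refine ⟨_, ?_, vertexDivisor_linEquiv hBA⟩
  rw [← vertexDivisor_zero]
  exact vertexDivisor_mono hB

/-- One divisor, found on the finite graph, and one estimate, proved on the metric graph, settle
both cases. The last two hypotheses place `r` in the window of `k`; the window of `k = m - 1` is
unbounded above, and `m = 0` is the one-vertex graph. -/
theorem isGonality_complete {m k : ℕ} (hm : Fintype.card V = m + 1) (hk : k ≤ m) {r s : ℤ}
    (hr : 0 ≤ r) (hs : 2 * s = 2 * r + 2 * k * m - k * (k + 1)) (hkr : k * (k + 1) ≤ 2 * r)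
    (hkr' : 2 * r ≤ k * (k + 3) ∨ k + 1 = m ∨ m = 0) :
    IsGonality (completeMetricGraph V).LinEquiv r s ∧
      IsGonality (SimpleGraph.completeGraph V).LinEquiv r s := by
  obtain ⟨o⟩ : Nonempty V := Fintype.card_pos_iff.mp (by omega)
  obtain ⟨A, hA, hAr⟩ := exists_divisor_of_rank (V := V)
    (P := fun A => (linearSystem (SimpleGraph.completeGraph V).LinEquiv A).Nonempty)
    (fun A hA => ⟨A, hA, completeGraph_linEquiv_refl A⟩)
    (fun A v ⟨B, hB, hBA⟩ =>
      ⟨B, hB, completeGraph_linEquiv_trans hBA (completeGraph_linEquiv_allVertices A v)⟩)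
    (fun A B ⟨C, hC, hCA⟩ hB => ⟨C + B, add_nonneg hC hB, completeGraph_linEquiv_add B hCA⟩)
    hm hk hr hs hkr'
  constructor
  · refine isGonality_of_bounds (Point.vertex o) (fun A B C h => h.add_right C) hr
      ⟨(completeMetricGraph V).vertexDivisor A, ?_, ?_⟩ fun n D hn hD => ?_
    · rw [divisorDegree_vertexDivisor, hA]
    · refine linearSystem_sub_nonempty_of_vertex hm _ fun B hB hdB => ?_
      rw [← vertexDivisor_sub]
      exact linearSystem_vertexDivisor_nonempty (hAr B hB hdB)
    · have h1 := le_divisorDegree_of_rank hm D (hr.trans hn) (fun E hE hdE => hD _ (by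
        rw [← vertexDivisor_zero]
        exact vertexDivisor_mono hE) (by rw [divisorDegree_vertexDivisor, hdE])) hk (by linarith)
      linarith
  · refine isGonality_of_bounds o (fun A B C h => completeGraph_linEquiv_add C h) hr
      ⟨A, hA, hAr⟩ fun n D hn hD => ?_
    have h1 := le_divisorDegree_of_rank hm ((completeMetricGraph V).vertexDivisor D) (hr.trans hn)
      (fun E hE hdE => by
        rw [← vertexDivisor_sub]
        exact linearSystem_vertexDivisor_nonempty (hD E hE hdE)) hk (by linarith)
    rw [divisorDegree_vertexDivisor] at h1
    linarith

end Complete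

/-! ### Arithmetic of `k` and `h`, and the main theorem -/

theorem two_mul_mul_add_three_ediv (k : ℤ) : 2 * (k * (k + 3) / 2) = k * (k + 3) := by
  refine Int.mul_ediv_cancel' (even_iff_two_dvd.mp ?_)
  rcases Int.even_or_odd k with h | h
  · exact h.mul_right _
  · exact (h.add_odd (by decide)).mul_left _

/-- The windows from k(k+1)/2 to k(k+3)/2 tile the positive integers, the next one starting at
k(k+3)/2 + 1. So `k` is the least `n` with `2 * r ≤ n * (n + 3)`. -/
theorem existsUnique_triangular {r D : ℤ} (hr : 1 ≤ r) (hD : 2 * r ≤ D * (D + 3)) (hD0 : 0 ≤ D) :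
    ∃! kh : ℤ × ℤ, 1 ≤ kh.1 ∧ kh.1 ≤ D ∧ 0 ≤ kh.2 ∧ kh.2 ≤ kh.1 ∧
      r = kh.1 * (kh.1 + 3) / 2 - kh.2 := by
  have hex : ∃ n : ℕ, 2 * r ≤ (n : ℤ) * (n + 3) :=
    ⟨D.toNat, by rwa [Int.toNat_of_nonneg hD0]⟩
  classical
  obtain ⟨n, hn, hmin⟩ : ∃ n : ℕ, 2 * r ≤ (n : ℤ) * (n + 3) ∧
      ∀ i < n, ¬2 * r ≤ (i : ℤ) * (i + 3) :=
    ⟨Nat.find hex, Nat.find_spec hex, fun i hi => Nat.find_min hex hi⟩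
  have hn1 : 1 ≤ n := by
    by_contra! h
    obtain rfl : n = 0 := by omega
    push_cast at hn
    linarith
  have hpred := hmin (n - 1) (by omega)
  rw [Nat.cast_sub hn1] at hpred
  push_cast at hpred
  push Not at hpred
  have h2 := two_mul_mul_add_three_ediv n
  have hn1z : (1 : ℤ) ≤ n := by exact_mod_cast hn1
  have hnD : (n : ℤ) ≤ D := by
    by_contra! h
    refine hmin D.toNat (by omega) ?_
    rwa [Int.toNat_of_nonneg hD0]
  refine ⟨((n : ℤ), (n : ℤ) * (n + 3) / 2 - r), ⟨hn1z, hnD, by linarith, ?_, by ring⟩, ?_⟩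
  · have : 2 * ((n : ℤ) * (n + 3) / 2 - r) < 2 * n + 2 := by
      rw [mul_sub, h2]
      linarith
    change (n : ℤ) * (n + 3) / 2 - r ≤ n
    linarith
  · rintro ⟨k, h⟩ ⟨hk1, hkD, hh0, hhk, hkr⟩
    simp only at hk1 hkD hh0 hhk hkr
    have h3 := two_mul_mul_add_three_ediv k
    have hkn : k = n := by
      rcases lt_trichotomy k n with hlt | heq | hgt
      · have : k ≤ n - 1 := by linarith
        nlinarith
      · exact heq
      · have : (n : ℤ) ≤ k - 1 := by linarith
        nlinarith
    subst hkn
    ext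
    · rfl
    · simp only
      linarith

end

theorem mainTheorem2 (d : ℕ) (hd : 1 ≤ d) (g : ℤ) (hg : g = ((d : ℤ) - 1) * ((d : ℤ) - 2) / 2)
    (r : ℤ) (hr : 1 ≤ r) :
    (r < g →
      (∃! kh : ℤ × ℤ, 1 ≤ kh.1 ∧ kh.1 ≤ (d : ℤ) - 3 ∧ 0 ≤ kh.2 ∧ kh.2 ≤ kh.1 ∧
        r = kh.1 * (kh.1 + 3) / 2 - kh.2) ∧
      ∀ k h : ℤ, 1 ≤ k → k ≤ (d : ℤ) - 3 → 0 ≤ h → h ≤ k → r = k * (k + 3) / 2 - h →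
        IsGonality (SimpleGraph.completeGraph (Fin d)).toMetricGraph.LinEquiv r (k * d - h) ∧
        IsGonality (SimpleGraph.completeGraph (Fin d)).LinEquiv r (k * d - h)) ∧
    (g ≤ r →
      IsGonality (SimpleGraph.completeGraph (Fin d)).toMetricGraph.LinEquiv r (g + r) ∧
      IsGonality (SimpleGraph.completeGraph (Fin d)).LinEquiv r (g + r)) := by
  obtain ⟨m, rfl⟩ : ∃ m, d = m + 1 := ⟨d - 1, by omega⟩
  have hg2 : 2 * g = m * (m - 1) := by
    have h1 := two_mul_mul_add_three_ediv ((m : ℤ) - 2)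
    have h2 : (((m + 1 : ℕ) : ℤ) - 1) * (((m + 1 : ℕ) : ℤ) - 2) =
        ((m : ℤ) - 2) * ((m : ℤ) - 2 + 3) + 1 * 2 := by
      push_cast
      ring
    rw [hg, h2, Int.add_mul_ediv_right _ _ (by norm_num), mul_add, h1]
    ring
  have hcard : Fintype.card (Fin (m + 1)) = m + 1 := Fintype.card_fin _
  refine ⟨fun hrg => ⟨?_, fun k h hk1 hkd hh0 hhk hkr => ?_⟩, fun hgr => ?_⟩
  · have hm2 : (2 : ℤ) ≤ m := by
      by_contra! hc
      have : (m : ℤ) = 0 ∨ (m : ℤ) = 1 := by omega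
      rcases this with h | h <;> rw [h] at hg2 <;> linarith
    refine existsUnique_triangular hr ?_ ?_
    · push_cast
      linarith
    · push_cast
      linarith
  · lift k to ℕ using by linarith
    push_cast at hkd
    have h1 := two_mul_mul_add_three_ediv k
    refine isGonality_complete hcard (k := k) (by omega) (by linarith) ?_ ?_ (Or.inl ?_)
    · push_cast
      linarith
    · linarith
    · linarith
  -- The choice `k = m - 1` makes the lower bound equal to `g + r`; for one vertex it would be
  -- negative, so `k = 0` is used instead.
  · rcases Nat.eq_zero_or_pos m with hm0 | hm0
    · subst hm0
      refine isGonality_complete hcard (k := 0) le_rfl (by linarith) ?_ ?_ (Or.inr (Or.inr rfl))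
      · push_cast at hg2 ⊢
        linarith
      · push_cast
        linarith
    · have hk : ((m - 1 : ℕ) : ℤ) = m - 1 := by rw [Nat.cast_sub hm0]; norm_num
      refine isGonality_complete hcard (k := m - 1) (by omega) (by linarith) ?_ ?_
        (Or.inr (Or.inl (by omega)))
      · rw [hk]
        linarith
      · rw [hk]
        linarith
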